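/- Consider a FIFO system of informative packets on a probability space. For each sample path, $\alpha_n$ and $\beta_n$ ($n=1,2,\dots$) denote the arrival time and the departure (information update) time of the $n$th packet, and it is assumed that $0=\beta_0<\beta_1$ and, for $n\ge 1$, $\alpha_n\le\alpha_{n+1}$ and $\alpha_n\le\beta_n<\beta_{n+1}$. Put $\alpha_0:=-A_0$, where $A_0\ge 0$ is the age of the information displayed at time $0$, and let $$D_n=\beta_n-\alpha_n\ (n\ge 0),\qquad A_{\mathrm{peak},n}=\beta_n-\alpha_{n-1}\ (n\ge 1),\qquad M_t=\sup\{n\ge 0:\beta_n\le t\},\qquad A_t=t-\alpha_{M_t}\ (t\ge 0)$$ be the system delays, the peak AoIs, the number of updates by time $t$ and the age of information (AoI). Suppose that, for some $\lambda^\dagger\in(0,\infty)$: (a) $\lim_{T\to\infty}\frac1T\sum_{n\ge1}\mathbf 1_{\{\alpha_n\le T\}}=\lambda^\dagger$ with probability one; (b) $\lim_{T\to\infty}M_T/T=\lambda^\dagger$ with probability one; (c) the marked point process $\{(\beta_n,D_n)\}_{n\ge0}$ is stationary and ergodic, either with respect to time shifts (the law of the process $(0,A_t),(\beta_{M_t+1}-t,D_{M_t+1}),(\beta_{M_t+2}-t,D_{M_t+2}),\dots$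 seen from $t$ does not depend on $t\ge0$, and every time-shift-invariant event has probability $0$ or $1$) or with respect to shifts from one update to the next (the sequence $\{(\beta_{n+1}-\beta_n,D_n)\}_{n\ge0}$ is stationary and ergodic). Then there are non-negative random variables $A$, $D$, $A_{\mathrm{peak}}$ (the stationary AoI, system delay and peak AoI), whose distribution functions $A(x)$, $D(x)$, $A_{\mathrm{peak}}(x)$ are, with probability one and for all $x\ge0$, the limits $$\lim_{T\to\infty}\frac1T\int_0^T\mathbf 1_{\{A_t\le x\}}\,dt,\qquad \lim_{N\to\infty}\frac1N\sum_{n=1}^N\mathbf 1_{\{D_n\le x\}},\qquad \lim_{N\to\infty}\frac1N\sum_{n=1}^N\mathbf 1_{\{A_{\mathrm{peak},n}\le x\}}.$$ Under stationarity with respect to updates, $D$ and $A_{\mathrm{peak}}$ have the law of $D_n$ and $A_{\mathrm{peak},n}$ for every $n\ge1$. Under stationarity in time, $A$ has the law of $A_t$ for every $t\ge0$, and $D$ and $A_{\mathrm{peak}}$ have the Palm laws: for $t\ge 0$ and every Borel set $B$, the expected number of $n\ge1$ with $\beta_n\le t$ and $D_n\in B$ (respectively $A_{\mathrm{peak},n}\in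 B$) is $\lambda^\dagger t\,\Pr(D\in B)$ (respectively $\lambda^\dagger t\,\Pr(A_{\mathrm{peak}}\in B)$). Moreover: (i) $A$ has the density $a(x)=\lambda^\dagger\,(D(x)-A_{\mathrm{peak}}(x))\ge0$, $x\ge0$; (ii) for every $s>0$, $$\mathrm E[e^{-sA}]=\lambda^\dagger\cdot\frac{\mathrm E[e^{-sD}]-\mathrm E[e^{-sA_{\mathrm{peak}}}]}{s};$$ (iii) for every $k=1,2,\dots$ with $\mathrm E[(A_{\mathrm{peak}})^{k+1}]<\infty$, the moments $\mathrm E[D^{k+1}]$ and $\mathrm E[A^k]$ are finite and $$\mathrm E[A^k]=\lambda^\dagger\cdot\frac{\mathrm E[(A_{\mathrm{peak}})^{k+1}]-\mathrm E[D^{k+1}]}{k+1}.$$ -/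

import Mathlib

open MeasureTheory ProbabilityTheory Filter Topology

noncomputable section

/-- The sample paths of a FIFO system in which only informative packets are visible.
For `n ≥ 1`, `α n` and `β n` are the arrival time and the departure (information update) time
of the `n`th packet. For `n = 0`, `β 0 = 0` is the time origin and `α 0` is the time-stamp of the
information displayed at time `0`, so that the AoI at time `0` is `-α 0 = β 0 - α 0 ≥ 0`. -/
structure FIFOSystem (Ω : Type*) [MeasurableSpace Ω] where
  α : ℕ → Ω → ℝ
  β : ℕ → Ω → ℝ
  measurable_α : ∀ n, Measurable (α n)
  measurable_β : ∀ n, Measurable (β n)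
  β_zero : ∀ ω, β 0 ω = 0
  β_lt : ∀ n ω, β n ω < β (n + 1) ω
  α_le_β : ∀ n ω, α n ω ≤ β n ω
  α_mono : ∀ n, 1 ≤ n → ∀ ω, α n ω ≤ α (n + 1) ω

namespace FIFOSystem

variable {Ω : Type*} [MeasurableSpace Ω] (S : FIFOSystem Ω)

/-- The system delay `D_n` of the `n`th packet; `D_0` is the AoI at time `0`. -/
def delay (n : ℕ) (ω : Ω) : ℝ := S.β n ω - S.α n ω

/-- The `n`th peak AoI, `n ≥ 1`: the AoI immediately before the `n`th update. -/
def peak (n : ℕ) (ω : Ω) : ℝ := S.β n ω - S.α (n - 1) ω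

/-- The number `M_t` of updates by time `t`. -/
def updates (t : ℝ) (ω : Ω) : ℕ := sSup {n : ℕ | S.β n ω ≤ t}

/-- The time-stamp of the information displayed at time `t`. -/
def timeStamp (t : ℝ) (ω : Ω) : ℝ := S.α (S.updates t ω) ω

/-- The age of information `A_t`. -/
def aoi (t : ℝ) (ω : Ω) : ℝ := t - S.timeStamp t ω

/-- The mean arrival rate exists with probability one and equals `lam`. (If infinitely many packets
arrive by some time, the sums below are `0` from then on, so the limit is not positive.) -/
def HasArrivalRate (μ : Measure Ω) (lam : ℝ) : Prop :=
  ∀ᵐ ω ∂μ, Tendsto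
    (fun T : ℝ => (1 / T) * ∑' n : ℕ, (Set.Iic T).indicator (fun _ => (1 : ℝ)) (S.α (n + 1) ω))
    atTop (𝓝 lam)

/-- The mean departure rate exists with probability one and equals `lam`. -/
def HasDepartureRate (μ : Measure Ω) (lam : ℝ) : Prop :=
  ∀ᵐ ω ∂μ, Tendsto (fun T : ℝ => (S.updates T ω : ℝ) / T) atTop (𝓝 lam)

/-- The marked point process `(β_n, D_n)`, `n = 0, 1, …`. -/
def marked (ω : Ω) : ℕ → ℝ × ℝ := fun n => (S.β n ω, S.delay n ω)

/-- The marked point process seen from time `t`: the origin is moved to `t`, its mark is the AoI at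
time `t`, and the following points are the updates after `t` with their delays. -/
def markedFrom (t : ℝ) (ω : Ω) : ℕ → ℝ × ℝ := fun k =>
  if k = 0 then (0, S.aoi t ω)
  else (S.β (S.updates t ω + k) ω - t, S.delay (S.updates t ω + k) ω)

/-- The sequence `(β_{n+1} - β_n, D_n)`, `n = 0, 1, …`, of the inter-update times and marks. -/
def increments (ω : Ω) : ℕ → ℝ × ℝ := fun n => (S.β (n + 1) ω - S.β n ω, S.delay n ω)

/-- Stationarity and ergodicity with respect to time shifts: the law of the marked point process
seen from `t` does not depend on `t ≥ 0`, and every event that is invariant under all time shifts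
has probability zero or one. -/
structure TimeStationaryErgodic (μ : Measure Ω) : Prop where
  stationary : ∀ t : ℝ, 0 ≤ t → μ.map (S.markedFrom t) = μ.map S.marked
  ergodic : ∀ B : Set (ℕ → ℝ × ℝ), MeasurableSet B →
    (∀ t : ℝ, 0 ≤ t → ∀ᵐ ω ∂μ, S.markedFrom t ω ∈ B ↔ S.marked ω ∈ B) →
    (∀ᵐ ω ∂μ, S.marked ω ∈ B) ∨ (∀ᵐ ω ∂μ, S.marked ω ∉ B)

/-- Stationarity and ergodicity with respect to shifts from one update to the next: the sequence
of inter-update times and marks is stationary and ergodic. -/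
def EventStationaryErgodic (μ : Measure Ω) : Prop :=
  Ergodic (fun (z : ℕ → ℝ × ℝ) n => z (n + 1)) (μ.map S.increments)

/-- `ν` is the asymptotic frequency distribution of the AoI process with probability one. -/
def IsTimeFrequencyLaw (μ : Measure Ω) (ν : Measure ℝ) : Prop :=
  ∀ᵐ ω ∂μ, ∀ x : ℝ, 0 ≤ x → Tendsto
    (fun T : ℝ => (1 / T) * ∫ t in (0 : ℝ)..T, (Set.Iic x).indicator (fun _ => (1 : ℝ)) (S.aoi t ω))
    atTop (𝓝 (cdf ν x))

end FIFOSystem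

/-- `ν` is the asymptotic frequency distribution of `Y 1, Y 2, …` with probability one. -/
def IsFrequencyLaw {Ω : Type*} [MeasurableSpace Ω] (μ : Measure Ω) (Y : ℕ → Ω → ℝ)
    (ν : Measure ℝ) : Prop :=
  ∀ᵐ ω ∂μ, ∀ x : ℝ, 0 ≤ x → Tendsto
    (fun N : ℕ => (1 / (N : ℝ)) *
      ∑ n ∈ Finset.Icc 1 N, (Set.Iic x).indicator (fun _ => (1 : ℝ)) (Y n ω))
    atTop (𝓝 (cdf ν x))

/-- A probability law of a non-negative random variable. -/
structure IsNonnegLaw (ν : Measure ℝ) : Prop where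
  isProbability : IsProbabilityMeasure ν
  nonneg : ∀ᵐ x ∂ν, 0 ≤ x

/-- The Laplace–Stieltjes transform of a law on the half-line. -/
def lst (ν : Measure ℝ) (s : ℝ) : ℝ := ∫ x, Real.exp (-s * x) ∂ν

namespace FIFOSystem

variable {Ω : Type*} [MeasurableSpace Ω] (S : FIFOSystem Ω)

/-- `PA`, `PD`, `PP` are the laws of the stationary AoI `A`, system delay `D` and peak AoI. They
are the asymptotic frequency distributions of `A_t`, `D_n` and of the peaks. If the
system is stationary with respect to updates, then `D` has the law of every `D_n` and the peak AoI
that of every peak. If it is stationary in time, then `A` has the law of every `A_t`, and `D` and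
the peak AoI have the laws at a typical update (the Palm laws): the mean number of updates in
`(0, t]` with mark in a Borel set `B` is `lam * t` times the probability of `B`. -/
structure AreStationaryLaws (μ : Measure Ω) (lam : ℝ) (PA PD PP : Measure ℝ) : Prop where
  law_A : IsNonnegLaw PA
  law_D : IsNonnegLaw PD
  law_P : IsNonnegLaw PP
  freq_A : S.IsTimeFrequencyLaw μ PA
  freq_D : IsFrequencyLaw μ S.delay PD
  freq_P : IsFrequencyLaw μ S.peak PP
  event_D : S.EventStationaryErgodic μ → ∀ n, 1 ≤ n → μ.map (S.delay n) = PD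
  event_P : S.EventStationaryErgodic μ → ∀ n, 1 ≤ n → μ.map (S.peak n) = PP
  time_A : S.TimeStationaryErgodic μ → ∀ t : ℝ, 0 ≤ t → μ.map (S.aoi t) = PA
  time_D : S.TimeStationaryErgodic μ → ∀ t : ℝ, 0 ≤ t → ∀ B : Set ℝ, MeasurableSet B →
    ∑' n : ℕ, μ {ω | S.β (n + 1) ω ≤ t ∧ S.delay (n + 1) ω ∈ B} = ENNReal.ofReal (lam * t) * PD B
  time_P : S.TimeStationaryErgodic μ → ∀ t : ℝ, 0 ≤ t → ∀ B : Set ℝ, MeasurableSet B →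
    ∑' n : ℕ, μ {ω | S.β (n + 1) ω ≤ t ∧ S.peak (n + 1) ω ∈ B} = ENNReal.ofReal (lam * t) * PP B

end FIFOSystem

end

/-! Between the updates `β n` and `β (n+1)` the AoI rises with slope one from `D_n` to the next
peak. The time it spends at or below `x` in this cycle is therefore the integral over levels `u` in
`[0, x]` of `1{D_n ≤ u} - 1{A_peak,n+1 ≤ u}` (`integral_leInd_aoi_cycle`). Summing over cycles and
dividing by `T`, with `M_T / T → λ`, the fraction of time at or below `x` tends to the integral of
`λ (D(u) - A_peak(u))` (`tendsto_timeAverage`). This is (i) for the measure `aoiLaw`, once the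
frequencies of delays and peaks are known to converge and `aoiLaw` to have mass one.

Convergence comes from the maximal ergodic theorem, used only as an upper bound
(`eventually_sum_le_of_stationary`). The bound is applied to an event and to its complement; their
sums add up to something with a known limit, so both upper bounds are sharp. With stationarity in
updates the terms are indicators along the increment sequence. With stationarity in time they are
counts of marked updates in unit intervals, and the limit law is the normalised mean count in `(0,
1]` (`palmLaw`).

The mass is one under stationarity in updates because it equals `λ E[β_1 - β_0]` by Fubini. Under
stationarity in time `aoiLaw` is the law of `A_0`, by taking expectations in the pathwise limit
(`map_delay_zero_eq_aoiLaw`). Parts (ii) and (iii) are the layer cake formula, with integrands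
`exp(-s t)` and `t ^ k`. -/

noncomputable section

/-! ### The maximal ergodic theorem. -/

section Ergodic

variable {X : Type*} {T : X → X}

/-- The running maxima `max (0, S₁ f, …, S_N f)` of the Birkhoff sums of `f`. -/
def birkhoffMax (T : X → X) (f : X → ℝ) : ℕ → X → ℝ
  | 0 => fun _ => 0
  | N + 1 => fun x => max 0 (f x + birkhoffMax T f N (T x))

lemma birkhoffMax_nonneg (f : X → ℝ) (N : ℕ) (x : X) : 0 ≤ birkhoffMax T f N x := by
  cases N with
  | zero => exact le_rfl
  | succ N => exact le_max_left _ _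

lemma birkhoffMax_le_succ (f : X → ℝ) (N : ℕ) (x : X) :
    birkhoffMax T f N x ≤ birkhoffMax T f (N + 1) x := by
  induction N generalizing x with
  | zero => exact birkhoffMax_nonneg f 1 x
  | succ N ih => exact max_le_max le_rfl (by gcongr; exact ih _)

lemma birkhoffSum_le_birkhoffMax (f : X → ℝ) (N : ℕ) (x : X) :
    birkhoffSum T f N x ≤ birkhoffMax T f N x := by
  induction N generalizing x with
  | zero => simp [birkhoffMax]
  | succ N ih =>
    rw [birkhoffSum_succ']
    exact le_max_of_le_right (by gcongr; exact ih _)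

lemma integrable_birkhoffMax [MeasurableSpace X] {ν : Measure X}
    (hT : MeasurePreserving T ν ν) {f : X → ℝ} (hf : Integrable f ν) (N : ℕ) :
    Integrable (birkhoffMax T f N) ν := by
  induction N with
  | zero => exact integrable_zero _ _ _
  | succ N ih =>
    exact (integrable_zero X ℝ ν).sup (hf.add (hT.integrable_comp_of_integrable ih))

/-- The maximal ergodic theorem, in the case in which some Birkhoff sum is positive almost
everywhere. -/
theorem integral_nonneg_of_exists_birkhoffSum_pos [MeasurableSpace X] {ν : Measure X}
    (hT : MeasurePreserving T ν ν) {f : X → ℝ}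
    (hf : Integrable f ν) (h : ∀ᵐ x ∂ν, ∃ n, 0 < birkhoffSum T f n x) : 0 ≤ ∫ x, f x ∂ν := by
  have hI := integrable_birkhoffMax hT hf
  have hmono : ∀ x, Monotone fun N => birkhoffMax T f N x := fun x =>
    monotone_nat_of_le_succ fun N => birkhoffMax_le_succ f N x
  let E : ℕ → Set X := fun N => {x | 0 < birkhoffMax T f N x}
  have hE : ∀ N, NullMeasurableSet (E N) ν := fun N =>
    nullMeasurableSet_lt aemeasurable_const (hI N).aemeasurable
  have key : ∀ N, 0 ≤ ∫ x, (E N).indicator f x ∂ν := by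
    intro N
    have h0 : ∫ x, (birkhoffMax T f N x - birkhoffMax T f N (T x)) ∂ν = 0 := by
      have h1 : ∫ x, birkhoffMax T f N (T x) ∂ν = ∫ x, birkhoffMax T f N x ∂ν := by
        have h2 : AEStronglyMeasurable (birkhoffMax T f N) (ν.map T) := by
          rw [hT.map_eq]; exact (hI N).aestronglyMeasurable
        rw [← integral_map hT.aemeasurable h2, hT.map_eq]
      have h3 : Integrable (fun x => birkhoffMax T f N (T x)) ν :=
        hT.integrable_comp_of_integrable (hI N)
      rw [integral_sub (hI N) h3, h1, sub_self]
    rw [← h0]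
    -- Where the maximum is positive it is `f x` plus the previous maximum at `T x`, so `f` is at
    -- least the difference; elsewhere the maximum is zero and the difference is at most zero.
    refine integral_mono ((hI N).sub (hT.integrable_comp_of_integrable (hI N)))
      (hf.indicator₀ (hE N)) fun x => ?_
    by_cases hx : x ∈ E N
    · simp only [Set.indicator_of_mem hx]
      cases N with
      | zero => exact absurd (show (0 : ℝ) < 0 from hx) (lt_irrefl _)
      | succ N =>
        have h1 : birkhoffMax T f (N + 1) x = f x + birkhoffMax T f N (T x) := by
          have hx' : 0 < max 0 (f x + birkhoffMax T f N (T x)) := hx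
          rcases lt_max_iff.1 hx' with h | h
          · exact absurd h (lt_irrefl _)
          · exact max_eq_right h.le
        have h2 := birkhoffMax_le_succ (T := T) f N (T x)
        linarith
    · simp only [Set.indicator_of_notMem hx]
      have h1 : birkhoffMax T f N x ≤ 0 := not_lt.1 hx
      have h2 := birkhoffMax_nonneg (T := T) f N (T x)
      linarith
  -- The sets `E N` increase to almost the whole space.
  refine ge_of_tendsto' (tendsto_integral_of_dominated_convergence (fun x => ‖f x‖)
    (fun N => (hf.indicator₀ (hE N)).aestronglyMeasurable) hf.norm
    (fun N => Eventually.of_forall fun x => norm_indicator_le_norm_self _ _) ?_) key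
  filter_upwards [h] with x ⟨n, hn⟩
  refine tendsto_const_nhds.congr' ?_
  filter_upwards [eventually_ge_atTop n] with N hN
  have : x ∈ E N := hn.trans_le ((birkhoffSum_le_birkhoffMax f n x).trans (hmono x hN))
  exact (Set.indicator_of_mem this f).symm

end Ergodic

/-! ### One-sided ergodic bounds and averages of stationary sequences. -/

/-- The upper growth rate of the sequence `s` exceeds `a`. -/
def GrowsFaster (a : ℝ) (s : ℕ → ℝ) : Prop :=
  ∃ m : ℕ, ∃ᶠ n : ℕ in atTop, (a + 1 / ((m : ℝ) + 1)) * n < s n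

lemma measurableSet_growsFaster {X : Type*} [MeasurableSpace X] {s : ℕ → X → ℝ}
    (hs : ∀ n, Measurable (s n)) (a : ℝ) : MeasurableSet {x | GrowsFaster a fun n => s n x} := by
  have : {x | GrowsFaster a fun n => s n x} = ⋃ m : ℕ, ⋂ N : ℕ, ⋃ n : ℕ, ⋃ _ : N ≤ n,
      {x | (a + 1 / ((m : ℝ) + 1)) * n < s n x} := by
    ext x
    simp only [GrowsFaster, frequently_atTop, Set.mem_ofPred_eq, Set.mem_iUnion, Set.mem_iInter,
      exists_prop]
  rw [this]
  exact .iUnion fun m => .iInter fun N => .iUnion fun n => .iUnion fun _ =>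
    measurableSet_lt measurable_const (hs n)

/-- Lowering the slack from `1/(m+1)` to `1/(m+2)` frees an amount linear in `n`, which eventually
absorbs the index shift `p` and the constant `C`. Growth events are thus invariant under shifts of
the sequence or of the time origin. -/
lemma GrowsFaster.of_le_shift {a C : ℝ} {p : ℕ} {s s' : ℕ → ℝ} (h : GrowsFaster a s')
    (hle : ∀ n, s' n ≤ s (n + p) + C) : GrowsFaster a s := by
  obtain ⟨m, hm⟩ := h
  have hm1 : (0 : ℝ) < (m : ℝ) + 1 := by positivity
  refine ⟨m + 1, ?_⟩
  set e : ℝ := 1 / ((m : ℝ) + 1) with he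
  set e' : ℝ := 1 / (((m + 1 : ℕ) : ℝ) + 1) with he'
  have hee : e' < e := by
    rw [he, he']; push_cast
    exact one_div_lt_one_div_of_lt hm1 (by linarith)
  obtain ⟨N, hN⟩ := exists_nat_gt (((a + e') * p + C) / (e - e'))
  rw [frequently_atTop] at hm ⊢
  intro k
  obtain ⟨n, hn, hlt⟩ := hm (max k N)
  refine ⟨n + p, by have := le_max_left k N; omega, ?_⟩
  have h1 : (N : ℝ) ≤ n := by exact_mod_cast (le_max_right k N).trans hn
  have h2 : (a + e') * p + C < n * (e - e') := by
    rw [← div_lt_iff₀ (by linarith)]; linarith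
  have h3 := hle n
  push_cast
  linarith

section Stationary

variable {Ω : Type*} [MeasurableSpace Ω] {μ : Measure Ω}

/-- One-sided ergodic bound: the averages of a stationary sequence are eventually at most any
number above the mean, if the upper growth rate of the partial sums is almost surely constant. -/
theorem eventually_sum_le_of_stationary [IsProbabilityMeasure μ] {Y : ℕ → Ω → ℝ}
    (hY : ∀ n, Measurable (Y n))
    (hst : μ.map (fun ω n => Y (n + 1) ω) = μ.map (fun ω n => Y n ω))
    (hint : Integrable (Y 0) μ) {b : ℝ} (hb : ∫ ω, Y 0 ω ∂μ < b)
    (htriv : ∀ a, (∀ᵐ ω ∂μ, GrowsFaster a fun n => ∑ k ∈ Finset.range n, Y k ω) ∨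
      ∀ᵐ ω ∂μ, ¬ GrowsFaster a fun n => ∑ k ∈ Finset.range n, Y k ω) :
    ∀ᵐ ω ∂μ, ∀ᶠ n : ℕ in atTop, ∑ k ∈ Finset.range n, Y k ω ≤ b * n := by
  -- Growth faster than some `a` above the mean is excluded: it would make some Birkhoff sum of `Y 0
  -- - a` positive almost surely, and the maximal theorem would give a mean of at least `a`.
  obtain ⟨a, ha, hab⟩ := exists_between hb
  rcases htriv a with h | h
  · exfalso
    let Z : Ω → ℕ → ℝ := fun ω n => Y n ω
    have hZ : Measurable Z := measurable_pi_lambda _ hY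
    let T : (ℕ → ℝ) → ℕ → ℝ := fun z n => z (n + 1)
    have hTm : Measurable T := measurable_pi_lambda _ fun n => measurable_pi_apply _
    have hT : MeasurePreserving T (μ.map Z) (μ.map Z) := by
      refine ⟨hTm, ?_⟩
      rw [Measure.map_map hTm hZ]
      exact hst
    have hTi : ∀ k z, T^[k] z = fun n => z (n + k) := by
      intro k
      induction k with
      | zero => intro z; rfl
      | succ k ih =>
        intro z
        rw [Function.iterate_succ_apply, ih]
        funext n
        change z (n + k + 1) = z (n + (k + 1))
        rw [add_assoc]
    have hfm : Measurable fun z : ℕ → ℝ => z 0 - a :=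
      Measurable.sub_const (measurable_pi_apply (X := fun _ : ℕ => ℝ) 0) a
    have hf : Integrable (fun z : ℕ → ℝ => z 0 - a) (μ.map Z) := by
      rw [integrable_map_measure hfm.aestronglyMeasurable hZ.aemeasurable]
      exact hint.sub (integrable_const a)
    have hsum : ∀ n z, birkhoffSum T (fun z : ℕ → ℝ => z 0 - a) n z
        = ∑ k ∈ Finset.range n, z k - a * n := by
      intro n z
      simp only [birkhoffSum, hTi, zero_add, Finset.sum_sub_distrib, Finset.sum_const,
        Finset.card_range, nsmul_eq_mul]
      ring
    have hpos : ∀ᵐ z ∂μ.map Z, ∃ n, 0 < birkhoffSum T (fun z : ℕ → ℝ => z 0 - a) n z := by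
      simp only [hsum]
      have hms : MeasurableSet {z : ℕ → ℝ | ∃ n : ℕ, 0 < ∑ k ∈ Finset.range n, z k - a * n} := by
        have : {z : ℕ → ℝ | ∃ n : ℕ, 0 < ∑ k ∈ Finset.range n, z k - a * n}
            = ⋃ n : ℕ, {z : ℕ → ℝ | 0 < ∑ k ∈ Finset.range n, z k - a * n} := by ext; simp
        rw [this]
        exact .iUnion fun n => measurableSet_lt measurable_const
          ((Finset.measurable_sum _ fun k _ => measurable_pi_apply k).sub_const _)
      rw [ae_map_iff hZ.aemeasurable hms]
      filter_upwards [h] with ω ⟨m, hm⟩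
      obtain ⟨n, hn⟩ := hm.exists
      refine ⟨n, ?_⟩
      have : (0 : ℝ) ≤ 1 / ((m : ℝ) + 1) * n := by positivity
      simp only [Z]
      linarith
    have := integral_nonneg_of_exists_birkhoffSum_pos hT hf hpos
    rw [integral_map hZ.aemeasurable hfm.aestronglyMeasurable] at this
    simp only [Z] at this
    rw [integral_sub hint (integrable_const a)] at this
    simp only [integral_const, probReal_univ, smul_eq_mul, one_mul] at this
    linarith
  · obtain ⟨m, hm⟩ := exists_nat_one_div_lt (sub_pos.2 hab)
    filter_upwards [h] with ω hω
    simp only [GrowsFaster, not_exists, not_frequently, not_lt] at hω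
    filter_upwards [hω m] with n hn
    refine hn.trans ?_
    gcongr
    linarith

/-- If the averages of identically distributed non-negative variables converge almost surely to a
constant, then this constant is the mean. -/
theorem lintegral_eq_of_tendsto_average [IsProbabilityMeasure μ] {Y : ℕ → Ω → ENNReal}
    (hY : ∀ n, Measurable (Y n))
    (hid : ∀ n, μ.map (Y n) = μ.map (Y 0)) {c : ENNReal}
    (hlim : ∀ᵐ ω ∂μ, Tendsto (fun n : ℕ => (∑ k ∈ Finset.range n, Y k ω) / n) atTop (𝓝 c)) :
    ∫⁻ ω, Y 0 ω ∂μ = c := by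
  have havg : ∀ g : ENNReal → ENNReal, Measurable g → ∀ n : ℕ, n ≠ 0 →
      ∫⁻ ω, (∑ k ∈ Finset.range n, g (Y k ω)) / n ∂μ = ∫⁻ ω, g (Y 0 ω) ∂μ := by
    intro g hg n hn
    have h1 : ∀ k, ∫⁻ ω, g (Y k ω) ∂μ = ∫⁻ ω, g (Y 0 ω) ∂μ := fun k => by
      rw [← lintegral_map hg (hY k), ← lintegral_map hg (hY 0), hid k]
    simp only [div_eq_mul_inv]
    have hm : ∀ k, Measurable fun ω => g (Y k ω) := fun k => hg.comp (hY k)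
    rw [lintegral_mul_const _ (Finset.measurable_sum _ fun k _ => hm k),
      lintegral_finsetSum _ (fun k _ => hm k)]
    simp only [h1, Finset.sum_const, Finset.card_range, nsmul_eq_mul]
    rw [mul_comm, ← mul_assoc, ENNReal.inv_mul_cancel (by simpa using hn)
      (ENNReal.natCast_ne_top n), one_mul]
  have hmeas : ∀ g : ENNReal → ENNReal, Measurable g → ∀ n : ℕ,
      Measurable fun ω => (∑ k ∈ Finset.range n, g (Y k ω)) / n := fun g hg n =>
    (Finset.measurable_sum _ fun k _ => hg.comp (hY k)).div_const _
  apply le_antisymm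
  -- The reverse Fatou lemma needs an integrable majorant, which truncation at `K` supplies;
  -- monotone convergence then removes `K`. No integrability of `Y 0` is presupposed.
  · have htr : ∀ K : ℕ, ∫⁻ ω, min (Y 0 ω) K ∂μ ≤ c := by
      intro K
      have hg : Measurable fun y : ENNReal => min y K := measurable_id.min measurable_const
      have h1 : Tendsto (fun n : ℕ => ∫⁻ ω, (∑ k ∈ Finset.range n, min (Y k ω) K) / n ∂μ) atTop
          (𝓝 (∫⁻ ω, min (Y 0 ω) K ∂μ)) := by
        refine tendsto_const_nhds.congr' ?_
        filter_upwards [eventually_ne_atTop 0] with n hn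
        exact (havg _ hg n hn).symm
      rw [← h1.limsup_eq]
      refine (limsup_lintegral_le (fun _ => (K : ENNReal)) (fun n => hmeas _ hg n) ?_ ?_).trans ?_
      · intro n
        refine Eventually.of_forall fun ω => ?_
        refine ENNReal.div_le_of_le_mul ?_
        calc ∑ k ∈ Finset.range n, min (Y k ω) (K : ENNReal)
            ≤ ∑ _k ∈ Finset.range n, (K : ENNReal) := Finset.sum_le_sum fun k _ => min_le_right _ _
          _ = K * n := by simp [mul_comm]
      · simp
      · calc ∫⁻ ω, limsup (fun n : ℕ => (∑ k ∈ Finset.range n, min (Y k ω) K) / n) atTop ∂μ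
            ≤ ∫⁻ _ω, c ∂μ := by
              refine lintegral_mono_ae ?_
              filter_upwards [hlim] with ω hω
              rw [← hω.limsup_eq]
              refine limsup_le_limsup (Eventually.of_forall fun n => ?_)
              exact ENNReal.div_le_div_right (Finset.sum_le_sum fun k _ => min_le_left _ _) _
          _ = c := by simp
    have hmono : ∀ ω, Monotone fun K : ℕ => min (Y 0 ω) (K : ENNReal) := fun ω K L h =>
      min_le_min le_rfl (by exact_mod_cast h)
    have hsup : ∀ ω, ⨆ K : ℕ, min (Y 0 ω) (K : ENNReal) = Y 0 ω := fun ω => by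
      rw [← inf_iSup_eq, ENNReal.iSup_natCast]
      simp
    calc ∫⁻ ω, Y 0 ω ∂μ = ∫⁻ ω, ⨆ K : ℕ, min (Y 0 ω) (K : ENNReal) ∂μ := by simp only [hsup]
      _ = ⨆ K : ℕ, ∫⁻ ω, min (Y 0 ω) (K : ENNReal) ∂μ :=
          lintegral_iSup (fun K => (hY 0).min measurable_const) fun K L h ω => hmono ω h
      _ ≤ c := iSup_le htr
  -- The other inequality is Fatou's lemma, since every average has the same mean as `Y 0`.
  · have h1 : Tendsto (fun n : ℕ => ∫⁻ ω, (∑ k ∈ Finset.range n, Y k ω) / n ∂μ) atTop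
        (𝓝 (∫⁻ ω, Y 0 ω ∂μ)) := by
      refine tendsto_const_nhds.congr' ?_
      filter_upwards [eventually_ne_atTop 0] with n hn
      exact (havg _ measurable_id n hn).symm
    calc c = ∫⁻ _ω, c ∂μ := by simp
      _ = ∫⁻ ω, liminf (fun n : ℕ => (∑ k ∈ Finset.range n, Y k ω) / n) atTop ∂μ := by
          refine lintegral_congr_ae ?_
          filter_upwards [hlim] with ω hω
          exact hω.liminf_eq.symm
      _ ≤ liminf (fun n : ℕ => ∫⁻ ω, (∑ k ∈ Finset.range n, Y k ω) / n ∂μ) atTop :=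
          lintegral_liminf_le fun n => hmeas _ measurable_id n
      _ = ∫⁻ ω, Y 0 ω ∂μ := h1.liminf_eq

/-- If the empirical frequencies of every half-line converge almost surely, then they do so for all
half-lines simultaneously. -/
theorem isFrequencyLaw_of_forall_ae {Y : ℕ → Ω → ℝ} {ν : Measure ℝ}
    (h : ∀ x : ℝ, ∀ᵐ ω ∂μ, Tendsto (fun N : ℕ => (1 / (N : ℝ)) *
      ∑ n ∈ Finset.Icc 1 N, (Set.Iic x).indicator (fun _ => (1 : ℝ)) (Y n ω))
      atTop (𝓝 (cdf ν x))) : IsFrequencyLaw μ Y ν := by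
  -- The limit has countably many discontinuities. One null set serves them and the rationals; a
  -- continuity point is squeezed between rationals.
  have hc := (monotone_cdf ν).countable_not_continuousAt
  have h1 : ∀ᵐ ω ∂μ, ∀ q : ℚ, Tendsto (fun N : ℕ => (1 / (N : ℝ)) *
      ∑ n ∈ Finset.Icc 1 N, (Set.Iic (q : ℝ)).indicator (fun _ => (1 : ℝ)) (Y n ω))
      atTop (𝓝 (cdf ν q)) := ae_all_iff.2 fun q => h q
  have h2 := (ae_ball_iff hc).2 fun x _ => h x
  filter_upwards [h1, h2] with ω hω1 hω2 x _
  by_cases hx : ContinuousAt (cdf ν) x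
  swap
  · exact hω2 x hx
  have hmono : ∀ (N : ℕ) (y z : ℝ), y ≤ z → (1 / (N : ℝ)) *
      ∑ n ∈ Finset.Icc 1 N, (Set.Iic y).indicator (fun _ => (1 : ℝ)) (Y n ω) ≤ (1 / (N : ℝ)) *
      ∑ n ∈ Finset.Icc 1 N, (Set.Iic z).indicator (fun _ => (1 : ℝ)) (Y n ω) := by
    intro N y z hyz
    refine mul_le_mul_of_nonneg_left (Finset.sum_le_sum fun n _ => ?_) (by positivity)
    exact Set.indicator_le_indicator_of_subset (Set.Iic_subset_Iic.2 hyz) (fun _ => zero_le_one) _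
  rw [tendsto_order]
  constructor
  · intro a ha
    have hev := hx.eventually (lt_mem_nhds ha)
    obtain ⟨l, hl, hlx⟩ := exists_Ioc_subset_of_mem_nhds hev ⟨x - 1, by linarith⟩
    obtain ⟨q, hq1, hq2⟩ := exists_rat_btwn hl
    have hq : a < cdf ν q := hlx ⟨hq1, hq2.le⟩
    filter_upwards [(hω1 q).eventually (lt_mem_nhds hq)] with N hN
    exact hN.trans_le (hmono N _ _ hq2.le)
  · intro a ha
    have hev := hx.eventually (gt_mem_nhds ha)
    obtain ⟨l, hl, hlx⟩ := exists_Ico_subset_of_mem_nhds hev ⟨x + 1, by linarith⟩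
    obtain ⟨q, hq1, hq2⟩ := exists_rat_btwn hl
    have hq : cdf ν q < a := hlx ⟨hq1.le, hq2⟩
    filter_upwards [(hω1 q).eventually (gt_mem_nhds hq)] with N hN
    exact (hmono N _ _ hq1.le).trans_lt hN

end Stationary

/-! ### Integrals of half-line indicators. -/

/-- The indicator of `y ≤ x`. -/
abbrev leInd (x y : ℝ) : ℝ := (Set.Iic x).indicator (fun _ => (1 : ℝ)) y

lemma leInd_of_le {x y : ℝ} (h : y ≤ x) : leInd x y = 1 := Set.indicator_of_mem (Set.mem_Iic.2 h) _

lemma leInd_of_lt {x y : ℝ} (h : x < y) : leInd x y = 0 :=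
  Set.indicator_of_notMem (fun h' => absurd (Set.mem_Iic.1 h') (not_le.2 h)) _

lemma leInd_nonneg (x y : ℝ) : 0 ≤ leInd x y := Set.indicator_nonneg (fun _ _ => zero_le_one) _

lemma leInd_le_one (x y : ℝ) : leInd x y ≤ 1 :=
  Set.indicator_apply_le' (fun _ => le_rfl) fun _ => zero_le_one

lemma leInd_anti {x y z : ℝ} (h : y ≤ z) : leInd x z ≤ leInd x y := by
  by_cases hz : z ≤ x
  · rw [leInd_of_le hz, leInd_of_le (h.trans hz)]
  · rw [leInd_of_lt (not_le.1 hz)]; exact leInd_nonneg x y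

lemma leInd_mono {x x' : ℝ} (y : ℝ) (h : x ≤ x') : leInd x y ≤ leInd x' y :=
  Set.indicator_le_indicator_of_subset (Set.Iic_subset_Iic.2 h) (fun _ => zero_le_one) _

lemma measurable_leInd (x : ℝ) : Measurable (leInd x) :=
  measurable_const.indicator measurableSet_Iic

lemma measurable_leInd_left (y : ℝ) : Measurable fun x => leInd x y :=
  (show Monotone fun x => leInd x y from fun _ _ h => leInd_mono y h).measurable

lemma intervalIntegrable_of_mem_unit {f : ℝ → ℝ} (hf : Measurable f) (h0 : ∀ x, 0 ≤ f x)
    (h1 : ∀ x, f x ≤ 1) (a b : ℝ) : IntervalIntegrable f volume a b := by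
  refine (intervalIntegrable_const (c := (1 : ℝ))).mono_fun hf.aestronglyMeasurable ?_
  refine Eventually.of_forall fun x => ?_
  simp only [Real.norm_of_nonneg (h0 x), norm_one]
  exact h1 x

lemma integral_leInd {d p x : ℝ} (hdp : d ≤ p) :
    ∫ u in d..p, leInd x u = min x p - min x d := by
  rcases le_total x d with h | h
  · have : ∫ u in d..p, leInd x u = ∫ u in d..p, (0 : ℝ) := by
      refine intervalIntegral.integral_congr_ae (Eventually.of_forall fun u hu => ?_)
      rw [Set.uIoc_of_le hdp] at hu
      exact leInd_of_lt (h.trans_lt hu.1)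
    rw [this, min_eq_left h, min_eq_left (h.trans hdp)]
    simp
  · rw [min_eq_right h]
    have hI : ∀ a b, IntervalIntegrable (leInd x) volume a b :=
      intervalIntegrable_of_mem_unit (measurable_leInd x) (leInd_nonneg x) (leInd_le_one x)
    have hdm : d ≤ min x p := le_min h hdp
    have hmp : min x p ≤ p := min_le_right _ _
    rw [← intervalIntegral.integral_add_adjacent_intervals (hI d (min x p)) (hI (min x p) p)]
    have h1 : ∫ u in d..(min x p), leInd x u = ∫ u in d..(min x p), (1 : ℝ) := by
      refine intervalIntegral.integral_congr_ae (Eventually.of_forall fun u hu => ?_)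
      rw [Set.uIoc_of_le hdm] at hu
      exact leInd_of_le (hu.2.trans (min_le_left _ _))
    have h2 : ∫ u in (min x p)..p, leInd x u = ∫ u in (min x p)..p, (0 : ℝ) := by
      refine intervalIntegral.integral_congr_ae (Eventually.of_forall fun u hu => ?_)
      rw [Set.uIoc_of_le hmp] at hu
      rcases min_lt_iff.1 hu.1 with h' | h'
      · exact leInd_of_lt h'
      · exact absurd hu.2 (not_le.2 h')
    rw [h1, h2]
    simp

lemma integral_leInd_left {d x : ℝ} (hd : 0 ≤ d) (hx : 0 ≤ x) :
    ∫ u in (0 : ℝ)..x, leInd u d = x - min x d := by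
  have hI : ∀ a b, IntervalIntegrable (fun u => leInd u d) volume a b :=
    intervalIntegrable_of_mem_unit (measurable_leInd_left d) (leInd_nonneg · d) (leInd_le_one · d)
  rw [← intervalIntegral.integral_add_adjacent_intervals (hI 0 (min x d)) (hI (min x d) x)]
  have h1 : ∫ u in (0 : ℝ)..(min x d), leInd u d = ∫ u in (0 : ℝ)..(min x d), (0 : ℝ) := by
    refine intervalIntegral.integral_congr_ae ?_
    -- The indicator is already one at `u = d`; that point is null.
    filter_upwards [(Set.countable_singleton d).ae_notMem volume] with u hud hu
    rw [Set.uIoc_of_le (le_min hx hd)] at hu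
    exact leInd_of_lt (lt_of_le_of_ne (hu.2.trans (min_le_right _ _)) hud)
  have h2 : ∫ u in (min x d)..x, leInd u d = ∫ u in (min x d)..x, (1 : ℝ) := by
    refine intervalIntegral.integral_congr_ae (Eventually.of_forall fun u hu => ?_)
    rw [Set.uIoc_of_le (min_le_left _ _)] at hu
    rcases min_lt_iff.1 hu.1 with h' | h'
    · exact absurd hu.2 (not_le.2 h')
    · exact leInd_of_le h'.le
  rw [h1, h2]
  simp

/-! ### Sample paths: from cycles to time averages. -/

namespace FIFOSystem

variable {Ω : Type*} [MeasurableSpace Ω] (S : FIFOSystem Ω) {ω : Ω} {lam : ℝ}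

lemma strictMono_β (ω : Ω) : StrictMono fun n => S.β n ω := strictMono_nat_of_lt_succ (S.β_lt · ω)

lemma β_nonneg (n : ℕ) (ω : Ω) : 0 ≤ S.β n ω := by
  rw [← S.β_zero ω]; exact (S.strictMono_β ω).monotone (Nat.zero_le n)

lemma measurable_delay (n : ℕ) : Measurable (S.delay n) := (S.measurable_β n).sub (S.measurable_α n)

lemma measurable_peak (n : ℕ) : Measurable (S.peak n) :=
  (S.measurable_β n).sub (S.measurable_α (n - 1))

lemma measurable_marked : Measurable S.marked :=
  measurable_pi_lambda _ fun n => (S.measurable_β n).prodMk (S.measurable_delay n)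

lemma delay_nonneg (n : ℕ) (ω : Ω) : 0 ≤ S.delay n ω := sub_nonneg.2 (S.α_le_β n ω)

lemma delay_lt_peak_succ (n : ℕ) (ω : Ω) : S.delay n ω < S.peak (n + 1) ω :=
  sub_lt_sub_right (S.β_lt n ω) _

lemma peak_nonneg {n : ℕ} (hn : 1 ≤ n) (ω : Ω) : 0 ≤ S.peak n ω := by
  obtain ⟨m, rfl⟩ := Nat.exists_eq_add_of_le' hn
  exact (S.delay_nonneg m ω).trans (S.delay_lt_peak_succ m ω).le

lemma delay_le_peak {n : ℕ} (hn : 2 ≤ n) (ω : Ω) : S.delay n ω ≤ S.peak n ω := by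
  obtain ⟨m, rfl⟩ := Nat.exists_eq_add_of_le' hn
  exact sub_le_sub_left (S.α_mono (m + 1) (Nat.le_add_left 1 m) ω) _

lemma updates_eq {n : ℕ} {t : ℝ} (h1 : S.β n ω ≤ t) (h2 : t < S.β (n + 1) ω) :
    S.updates t ω = n := by
  have : {k : ℕ | S.β k ω ≤ t} = Set.Iic n := by
    ext k
    refine ⟨fun hk => ?_, fun hk => ((S.strictMono_β ω).monotone hk).trans h1⟩
    exact Nat.lt_succ_iff.1 ((S.strictMono_β ω).lt_iff_lt.1 (lt_of_le_of_lt hk h2))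
  rw [updates, this, csSup_Iic]

lemma updates_β (n : ℕ) : S.updates (S.β n ω) ω = n := S.updates_eq le_rfl (S.β_lt n ω)

lemma aoi_eq {n : ℕ} {t : ℝ} (h1 : S.β n ω ≤ t) (h2 : t < S.β (n + 1) ω) :
    S.aoi t ω = t - S.α n ω := by
  rw [aoi, timeStamp, S.updates_eq h1 h2]

/-- Updates do not accumulate if the departure rate is positive. -/
lemma tendsto_β_atTop (hlam : 0 < lam)
    (h : Tendsto (fun T : ℝ => (S.updates T ω : ℝ) / T) atTop (𝓝 lam)) :
    Tendsto (fun n => S.β n ω) atTop atTop := by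
  rcases tendsto_atTop_of_monotone (S.strictMono_β ω).monotone with h' | ⟨l, hl⟩
  · exact h'
  exfalso
  have hle : ∀ n, S.β n ω ≤ l := fun n => (S.strictMono_β ω).monotone.ge_of_tendsto hl n
  have h0 : Tendsto (fun T : ℝ => (S.updates T ω : ℝ) / T) atTop (𝓝 0) := by
    refine tendsto_const_nhds.congr' ?_
    filter_upwards [eventually_ge_atTop l] with T hT
    have : S.updates T ω = 0 := by
      -- If updates accumulated at `l`, the index set would be unbounded for `T ≥ l`, its supremum
      -- would take the default value `0`, and the rate would vanish.
      refine Nat.sSup_of_not_bddAbove ?_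
      rintro ⟨m, hm⟩
      exact absurd (hm (show S.β (m + 1) ω ≤ T from (hle _).trans hT)) (by simp)
    simp [this]
  exact hlam.ne' (tendsto_nhds_unique h h0)

/-- The substitution `t - α n` turns time into age, giving `min x peak - min x delay`. Writing this
as an integral over levels makes it linear in the indicators, so that frequencies can be summed
under the integral. -/
lemma integral_leInd_aoi_cycle {x : ℝ} (hx : 0 ≤ x) (n : ℕ) :
    ∫ t in (S.β n ω)..(S.β (n + 1) ω), leInd x (S.aoi t ω)
      = ∫ u in (0 : ℝ)..x, (leInd u (S.delay n ω) - leInd u (S.peak (n + 1) ω)) := by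
  have h1 : ∫ t in (S.β n ω)..(S.β (n + 1) ω), leInd x (S.aoi t ω)
      = ∫ t in (S.β n ω)..(S.β (n + 1) ω), leInd x (t - S.α n ω) := by
    refine intervalIntegral.integral_congr_ae ?_
    filter_upwards [(Set.countable_singleton (S.β (n + 1) ω)).ae_notMem volume] with t ht ht'
    rw [Set.uIoc_of_le (S.β_lt n ω).le] at ht'
    rw [S.aoi_eq ht'.1.le (lt_of_le_of_ne ht'.2 ht)]
  have hI : ∀ d, IntervalIntegrable (fun u => leInd u d) volume 0 x := fun d =>
    intervalIntegrable_of_mem_unit (measurable_leInd_left d) (leInd_nonneg · d) (leInd_le_one · d)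
      _ _
  rw [h1, intervalIntegral.integral_comp_sub_right (leInd x),
    intervalIntegral.integral_sub (hI _) (hI _), integral_leInd_left (S.delay_nonneg n ω) hx,
    integral_leInd_left (S.peak_nonneg (Nat.le_add_left 1 n) ω) hx]
  have h2 : S.β n ω - S.α n ω = S.delay n ω := rfl
  have h3 : S.β (n + 1) ω - S.α n ω = S.peak (n + 1) ω := rfl
  rw [h2, h3, integral_leInd (S.delay_lt_peak_succ n ω).le]
  ring

section Regular

variable {S}

lemma bddAbove_updates (hβ : Tendsto (fun n => S.β n ω) atTop atTop)
    (t : ℝ) : BddAbove {n : ℕ | S.β n ω ≤ t} := by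
  obtain ⟨m, hm⟩ := (hβ.eventually_gt_atTop t).exists
  refine ⟨m, fun n hn => ?_⟩
  exact ((S.strictMono_β ω).lt_iff_lt.1 (lt_of_le_of_lt hn hm)).le

lemma β_updates_le (hβ : Tendsto (fun n => S.β n ω) atTop atTop)
    {t : ℝ} (ht : 0 ≤ t) : S.β (S.updates t ω) ω ≤ t :=
  Nat.sSup_mem (s := {n : ℕ | S.β n ω ≤ t}) ⟨0, (S.β_zero ω).trans_le ht⟩ (bddAbove_updates hβ t)

lemma lt_β_updates_succ (hβ : Tendsto (fun n => S.β n ω) atTop atTop)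
    (t : ℝ) : t < S.β (S.updates t ω + 1) ω := by
  by_contra! h
  exact absurd (le_csSup (bddAbove_updates hβ t) h) (by simp [updates])

lemma le_updates_iff (hβ : Tendsto (fun n => S.β n ω) atTop atTop)
    {t : ℝ} (ht : 0 ≤ t) (n : ℕ) : n ≤ S.updates t ω ↔ S.β n ω ≤ t := by
  refine ⟨fun h => ((S.strictMono_β ω).monotone h).trans (β_updates_le hβ ht), fun h => ?_⟩
  exact le_csSup (bddAbove_updates hβ t) h

lemma monotone_updates (hβ : Tendsto (fun n => S.β n ω) atTop atTop) :
    Monotone fun t => S.updates t ω := by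
  intro s t hst
  rcases lt_or_ge s 0 with hs | hs
  · have : {n : ℕ | S.β n ω ≤ s} = ∅ := by
      ext n
      simpa using hs.trans_le (S.β_nonneg n ω)
    simp [updates, this]
  · exact (le_updates_iff hβ (hs.trans hst) _).2 ((β_updates_le hβ hs).trans hst)

lemma measurable_aoi_path (hβ : Tendsto (fun n => S.β n ω) atTop atTop) :
    Measurable fun t => S.aoi t ω :=
  measurable_id.sub ((measurable_from_nat (f := fun n => S.α n ω)).comp
    (monotone_updates hβ).measurable)

lemma intervalIntegrable_leInd_aoi (hβ : Tendsto (fun n => S.β n ω) atTop atTop)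
    (x a b : ℝ) :
    IntervalIntegrable (fun t => leInd x (S.aoi t ω)) volume a b :=
  intervalIntegrable_of_mem_unit ((measurable_leInd x).comp (measurable_aoi_path hβ))
    (fun _ => leInd_nonneg _ _) (fun _ => leInd_le_one _ _) a b

lemma integral_leInd_aoi_β (hβ : Tendsto (fun n => S.β n ω) atTop atTop)
    {x : ℝ} (hx : 0 ≤ x) (N : ℕ) :
    ∫ t in (0 : ℝ)..(S.β N ω), leInd x (S.aoi t ω)
      = ∫ u in (0 : ℝ)..x,
        ∑ n ∈ Finset.range N, (leInd u (S.delay n ω) - leInd u (S.peak (n + 1) ω)) := by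
  have hI : ∀ d, IntervalIntegrable (fun u => leInd u d) volume 0 x := fun d =>
    intervalIntegrable_of_mem_unit (measurable_leInd_left d) (leInd_nonneg · d) (leInd_le_one · d)
      _ _
  rw [intervalIntegral.integral_finsetSum fun n _ => (hI _).sub (hI _)]
  simp only [← S.integral_leInd_aoi_cycle hx]
  rw [intervalIntegral.sum_integral_adjacent_intervals (a := fun n => S.β n ω)
    fun n _ => intervalIntegrable_leInd_aoi hβ x _ _, S.β_zero]

end Regular

lemma tendsto_updates_atTop (hlam : 0 < lam)
    (h : Tendsto (fun T : ℝ => (S.updates T ω : ℝ) / T) atTop (𝓝 lam)) :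
    Tendsto (fun T : ℝ => S.updates T ω) atTop atTop := by
  have hβ := S.tendsto_β_atTop hlam h
  refine tendsto_atTop.2 fun n => ?_
  filter_upwards [eventually_ge_atTop (S.β n ω), eventually_ge_atTop 0] with T hT hT0
  exact (le_updates_iff hβ hT0 n).2 hT

lemma tendsto_div_β (hlam : 0 < lam)
    (h : Tendsto (fun T : ℝ => (S.updates T ω : ℝ) / T) atTop (𝓝 lam)) :
    Tendsto (fun n : ℕ => (n : ℝ) / S.β n ω) atTop (𝓝 lam) := by
  refine (h.comp (S.tendsto_β_atTop hlam h)).congr fun n => ?_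
  simp only [Function.comp, updates_β]

lemma sum_Icc_eq_sum_range (f : ℕ → ℝ) (N : ℕ) :
    ∑ n ∈ Finset.Icc 1 N, f n = ∑ n ∈ Finset.range N, f (n + 1) := by
  induction N with
  | zero => simp
  | succ N ih => rw [Finset.sum_Icc_succ_top (Nat.le_add_left 1 N), ih, Finset.sum_range_succ]

/-- Along a path on which the delays and the peaks have limiting frequency distributions, the AoI
has a limiting frequency distribution. -/
theorem tendsto_timeAverage (hlam : 0 < lam)
    (h : Tendsto (fun T : ℝ => (S.updates T ω : ℝ) / T) atTop (𝓝 lam)) {F G : ℝ → ℝ}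
    (hF : ∀ x, 0 ≤ x → Tendsto (fun N : ℕ => (1 / (N : ℝ)) *
      ∑ n ∈ Finset.Icc 1 N, leInd x (S.delay n ω)) atTop (𝓝 (F x)))
    (hG : ∀ x, 0 ≤ x → Tendsto (fun N : ℕ => (1 / (N : ℝ)) *
      ∑ n ∈ Finset.Icc 1 N, leInd x (S.peak n ω)) atTop (𝓝 (G x))) {x : ℝ} (hx : 0 ≤ x) :
    Tendsto (fun T : ℝ => (1 / T) * ∫ t in (0 : ℝ)..T, leInd x (S.aoi t ω)) atTop
      (𝓝 (lam * ∫ u in (0 : ℝ)..x, (F u - G u))) := by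
  have hβ := S.tendsto_β_atTop hlam h
  set I : ℝ → ℝ := fun T => ∫ t in (0 : ℝ)..T, leInd x (S.aoi t ω) with hIdef
  set L : ℝ := ∫ u in (0 : ℝ)..x, (F u - G u) with hL
  have hImono : ∀ a b, a ≤ b → I a ≤ I b := by
    intro a b hab
    have h1 : I a + ∫ t in a..b, leInd x (S.aoi t ω) = I b :=
      intervalIntegral.integral_add_adjacent_intervals (intervalIntegrable_leInd_aoi hβ x _ _)
        (intervalIntegrable_leInd_aoi hβ x _ _)
    have h2 : 0 ≤ ∫ t in a..b, leInd x (S.aoi t ω) :=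
      intervalIntegral.integral_nonneg hab fun _ _ => leInd_nonneg _ _
    linarith
  -- Along the update epochs the frequencies converge at each level, and dominated convergence on
  -- `[0, x]` applies.
  have hlim : Tendsto (fun N : ℕ => (1 / (N : ℝ)) * I (S.β N ω)) atTop (𝓝 L) := by
    have heq : ∀ N : ℕ, (1 / (N : ℝ)) * I (S.β N ω) = ∫ u in (0 : ℝ)..x, (1 / (N : ℝ)) *
        ∑ n ∈ Finset.range N, (leInd u (S.delay n ω) - leInd u (S.peak (n + 1) ω)) := by
      intro N
      rw [intervalIntegral.integral_const_mul, hIdef]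
      simp only
      rw [integral_leInd_aoi_β hβ hx]
    simp only [heq]
    refine intervalIntegral.tendsto_integral_filter_of_dominated_convergence (fun _ => (1 : ℝ))
      ?_ ?_ intervalIntegrable_const ?_
    · refine Eventually.of_forall fun N => ?_
      exact (measurable_const.mul (Finset.measurable_sum _ fun n _ =>
        (measurable_leInd_left _).sub (measurable_leInd_left _))).aestronglyMeasurable
    · filter_upwards [eventually_gt_atTop 0] with N hN
      refine Eventually.of_forall fun u _ => ?_
      have hN' : (0 : ℝ) < N := by exact_mod_cast hN
      have h0 : ∀ n, 0 ≤ leInd u (S.delay n ω) - leInd u (S.peak (n + 1) ω) := fun n =>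
        sub_nonneg.2 (leInd_anti (S.delay_lt_peak_succ n ω).le)
      rw [Real.norm_of_nonneg (mul_nonneg (by positivity) (Finset.sum_nonneg fun n _ => h0 n))]
      have h1 : ∑ n ∈ Finset.range N, (leInd u (S.delay n ω) - leInd u (S.peak (n + 1) ω))
          ≤ ∑ _n ∈ Finset.range N, (1 : ℝ) := Finset.sum_le_sum fun n _ => by
        have := leInd_le_one u (S.delay n ω)
        have := leInd_nonneg u (S.peak (n + 1) ω)
        linarith
      simp only [Finset.sum_const, Finset.card_range, nsmul_eq_mul, mul_one] at h1
      rw [one_div, inv_mul_le_iff₀ hN', mul_one]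
      exact h1
    · refine Eventually.of_forall fun u hu => ?_
      rw [Set.uIoc_of_le hx] at hu
      -- The cycles involve the delays `0, …, N-1`, the frequencies the delays `1, …, N`; the
      -- discrepancy is of order `1/N`.
      have hbd : Tendsto (fun N : ℕ => (1 / (N : ℝ)) *
          (leInd u (S.delay 0 ω) - leInd u (S.delay N ω))) atTop (𝓝 0) := by
        refine squeeze_zero_norm (a := fun N : ℕ => 1 / (N : ℝ)) (fun N => ?_)
          tendsto_one_div_atTop_nhds_zero_nat
        rw [norm_mul, Real.norm_of_nonneg (by positivity : (0 : ℝ) ≤ 1 / N)]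
        refine mul_le_of_le_one_right (by positivity) ?_
        rw [Real.norm_eq_abs, abs_le]
        have := leInd_le_one u (S.delay 0 ω)
        have := leInd_nonneg u (S.delay 0 ω)
        have := leInd_le_one u (S.delay N ω)
        have := leInd_nonneg u (S.delay N ω)
        constructor <;> linarith
      have := ((hF u hu.1.le).add hbd).sub (hG u hu.1.le)
      rw [add_zero] at this
      refine this.congr fun N => ?_
      rw [Finset.sum_sub_distrib, sum_Icc_eq_sum_range, sum_Icc_eq_sum_range]
      have h1 := Finset.sum_range_succ (fun n => leInd u (S.delay n ω)) N
      have h2 := Finset.sum_range_succ' (fun n => leInd u (S.delay n ω)) N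
      rw [h1] at h2
      have h3 : ∑ n ∈ Finset.range N, leInd u (S.delay n ω)
          = ∑ n ∈ Finset.range N, leInd u (S.delay (n + 1) ω)
            + (leInd u (S.delay 0 ω) - leInd u (S.delay N ω)) := by linarith
      rw [h3]
      ring
  have hM := S.tendsto_updates_atTop hlam h
  have hlow : Tendsto (fun T : ℝ => ((S.updates T ω : ℝ) / T) *
      ((1 / (S.updates T ω : ℝ)) * I (S.β (S.updates T ω) ω))) atTop (𝓝 (lam * L)) :=
    h.mul (hlim.comp hM)
  have h1T : Tendsto (fun T : ℝ => (((S.updates T ω + 1 : ℕ) : ℝ)) / T) atTop (𝓝 lam) := by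
    have := h.add tendsto_inv_atTop_zero
    rw [add_zero] at this
    refine this.congr fun T => ?_
    push_cast
    rw [add_div, one_div]
  have hup : Tendsto (fun T : ℝ => (((S.updates T ω + 1 : ℕ) : ℝ) / T) *
      ((1 / ((S.updates T ω + 1 : ℕ) : ℝ)) * I (S.β (S.updates T ω + 1) ω))) atTop
      (𝓝 (lam * L)) :=
    h1T.mul (hlim.comp ((tendsto_add_atTop_nat 1).comp hM))
  -- `I` is monotone and `T` lies between two consecutive updates, whose bounds have the same limit.
  refine tendsto_of_tendsto_of_tendsto_of_le_of_le' hlow hup ?_ ?_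
  · filter_upwards [eventually_gt_atTop 0, hM.eventually_gt_atTop 0] with T hT hN
    have hN' : (0 : ℝ) < S.updates T ω := by exact_mod_cast hN
    have h2 := hImono _ _ (β_updates_le hβ hT.le)
    calc _ = (1 / T) * I (S.β (S.updates T ω) ω) := by field_simp
      _ ≤ _ := by gcongr
  · filter_upwards [eventually_gt_atTop 0] with T hT
    have h2 := hImono _ _ (lt_β_updates_succ hβ T).le
    have hN' : (0 : ℝ) < ((S.updates T ω + 1 : ℕ) : ℝ) := by positivity
    calc (1 / T) * I T ≤ (1 / T) * I (S.β (S.updates T ω + 1) ω) := by gcongr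
      _ = _ := by field_simp

/-- The limiting frequencies of the delays dominate those of the peaks. -/
theorem le_of_tendsto_frequencies {x F G : ℝ}
    (hF : Tendsto (fun N : ℕ => (1 / (N : ℝ)) *
      ∑ n ∈ Finset.Icc 1 N, leInd x (S.delay n ω)) atTop (𝓝 F))
    (hG : Tendsto (fun N : ℕ => (1 / (N : ℝ)) *
      ∑ n ∈ Finset.Icc 1 N, leInd x (S.peak n ω)) atTop (𝓝 G)) : G ≤ F := by
  have h0 : Tendsto (fun N : ℕ => (1 / (N : ℝ)) * ∑ n ∈ Finset.Icc 1 N, leInd x (S.delay n ω)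
      + 1 / (N : ℝ)) atTop (𝓝 F) := by
    simpa using hF.add tendsto_one_div_atTop_nhds_zero_nat
  refine le_of_tendsto_of_tendsto' hG h0 fun N => ?_
  -- The order of `α 0` and `α 1` is not prescribed, so the first peak may be below the first delay;
  -- this costs at most one.
  have : ∑ n ∈ Finset.Icc 1 N, leInd x (S.peak n ω)
      ≤ ∑ n ∈ Finset.Icc 1 N, leInd x (S.delay n ω) + 1 := by
    induction N with
    | zero => simp
    | succ N ih =>
      rw [Finset.sum_Icc_succ_top (Nat.le_add_left 1 N),
        Finset.sum_Icc_succ_top (Nat.le_add_left 1 N)]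
      rcases Nat.eq_zero_or_pos N with rfl | hN
      · have := leInd_le_one x (S.peak (0 + 1) ω)
        have := leInd_nonneg x (S.delay (0 + 1) ω)
        simp only [Finset.Icc_eq_empty_of_lt Nat.zero_lt_one, Finset.sum_empty]
        linarith
      · have := leInd_anti (x := x) (S.delay_le_peak (n := N + 1) (by omega) ω)
        linarith
  calc (1 / (N : ℝ)) * ∑ n ∈ Finset.Icc 1 N, leInd x (S.peak n ω)
      ≤ (1 / (N : ℝ)) * (∑ n ∈ Finset.Icc 1 N, leInd x (S.delay n ω) + 1) := by gcongr
    _ = _ := by ring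

end FIFOSystem

/-! ### Limits from two upper bounds. -/

/-- The upper bound for `s'`, subtracted from the known limit of the sum, is a lower bound for `s`.
-/
lemma tendsto_average_of_upper_bounds {s s' : ℕ → ℝ} {p p' : ℝ}
    (h : ∀ m : ℕ, ∀ᶠ n : ℕ in atTop, s n ≤ (p + 1 / ((m : ℝ) + 1)) * n)
    (h' : ∀ m : ℕ, ∀ᶠ n : ℕ in atTop, s' n ≤ (p' + 1 / ((m : ℝ) + 1)) * n)
    (hs : Tendsto (fun n : ℕ => (1 / (n : ℝ)) * (s n + s' n)) atTop (𝓝 (p + p'))) :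
    Tendsto (fun n : ℕ => (1 / (n : ℝ)) * s n) atTop (𝓝 p) := by
  have up : ∀ {r : ℕ → ℝ} {q : ℝ}, (∀ m : ℕ, ∀ᶠ n : ℕ in atTop,
      r n ≤ (q + 1 / ((m : ℝ) + 1)) * n) → ∀ c, q < c →
      ∀ᶠ n : ℕ in atTop, (1 / (n : ℝ)) * r n < c := by
    intro r q hr c hc
    obtain ⟨m, hm⟩ := exists_nat_one_div_lt (sub_pos.2 hc)
    filter_upwards [hr m, eventually_gt_atTop 0] with n hn hn0
    have hn0' : (0 : ℝ) < n := by exact_mod_cast hn0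
    rw [one_div, inv_mul_lt_iff₀ hn0']
    refine hn.trans_lt ?_
    rw [mul_comm]
    exact mul_lt_mul_of_pos_left (by linarith) hn0'
  rw [tendsto_order]
  refine ⟨fun c hc => ?_, fun c hc => up h c hc⟩
  have e1 := up h' (p' + (p - c) / 2) (by linarith)
  have e2 := hs.eventually (lt_mem_nhds (show p + p' - (p - c) / 2 < p + p' by linarith))
  filter_upwards [e1, e2] with n h1 h2
  rw [mul_add] at h2
  linarith

lemma indicator_one_nonneg {γ : Type*} (B : Set γ) (y : γ) :
    0 ≤ B.indicator (fun _ => (1 : ℝ)) y :=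
  Set.indicator_nonneg (fun _ _ => zero_le_one) _

/-- Birkhoff's theorem for the frequencies of an event along an ergodic sequence. -/
theorem tendsto_frequency_of_ergodic_shift {Ω γ : Type*} [MeasurableSpace Ω] [MeasurableSpace γ]
    {μ : Measure Ω} [IsProbabilityMeasure μ] {Z : Ω → ℕ → γ} (hZ : Measurable Z)
    (herg : Ergodic (fun (z : ℕ → γ) n => z (n + 1)) (μ.map Z)) {B : Set (ℕ → γ)}
    (hB : MeasurableSet B) :
    ∀ᵐ ω ∂μ, Tendsto (fun N : ℕ => (1 / (N : ℝ)) *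
      ∑ k ∈ Finset.range N, B.indicator (fun _ => (1 : ℝ)) (fun n => Z ω (n + k))) atTop
      (𝓝 (μ.real (Z ⁻¹' B))) := by
  -- Used for `B` and for `Bᶜ`, whose indicators add up to one.
  have upper : ∀ C : Set (ℕ → γ), MeasurableSet C → ∀ᵐ ω ∂μ, ∀ m : ℕ, ∀ᶠ N : ℕ in atTop,
      ∑ k ∈ Finset.range N, C.indicator (fun _ => (1 : ℝ)) (fun n => Z ω (n + k))
        ≤ (μ.real (Z ⁻¹' C) + 1 / ((m : ℝ) + 1)) * N := by
    intro C hC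
    rw [ae_all_iff]
    intro m
    let y : ℕ → (ℕ → γ) → ℝ := fun k z => C.indicator (fun _ => (1 : ℝ)) (fun n => z (n + k))
    have hy : ∀ k, Measurable (y k) := fun k =>
      (measurable_const.indicator hC).comp
        (measurable_pi_lambda _ fun n => measurable_pi_apply (n + k))
    have hy0 : ∫ ω, y 0 (Z ω) ∂μ = μ.real (Z ⁻¹' C) := by
      have : (fun ω => y 0 (Z ω)) = (Z ⁻¹' C).indicator 1 := by
        funext ω
        rfl
      rw [this, integral_indicator_one (hZ hC)]
    have hyT : ∀ k z, y k (fun n => z (n + 1)) = y (k + 1) z := by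
      intro k z
      simp only [y, add_assoc]
    refine eventually_sum_le_of_stationary (μ := μ) (Y := fun k ω => y k (Z ω))
      (fun k => (hy k).comp hZ) ?_ ?_ ?_ fun a => ?_
    · have hφ : Measurable fun z k => y k z := measurable_pi_lambda _ hy
      have h1 : (fun ω n => y (n + 1) (Z ω))
          = (fun z k => y k z) ∘ (fun (z : ℕ → γ) n => z (n + 1)) ∘ Z := by
        funext ω n
        exact (hyT n (Z ω)).symm
      rw [h1, ← Measure.map_map hφ (herg.measurable.comp hZ),
        ← Measure.map_map herg.measurable hZ, herg.map_eq, Measure.map_map hφ hZ]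
      rfl
    · refine Integrable.of_bound ((hy 0).comp hZ).aestronglyMeasurable 1
        (Eventually.of_forall fun ω => ?_)
      exact (norm_indicator_le_norm_self _ _).trans (by simp)
    · rw [hy0]
      have : (0 : ℝ) < 1 / ((m : ℝ) + 1) := by positivity
      linarith
    · let E : Set (ℕ → γ) := {z | GrowsFaster a fun n => ∑ k ∈ Finset.range n, y k z}
      have hE : MeasurableSet E :=
        measurableSet_growsFaster (fun n => Finset.measurable_sum _ fun k _ => hy k) a
      -- The partial sums along the shifted sequence lose only the first term and gain one at the
      -- end, so the growth event is invariant.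
      have hinv : (fun (z : ℕ → γ) n => z (n + 1)) ⁻¹' E = E := by
        ext z
        have hsum : ∀ n, ∑ k ∈ Finset.range n, y k (fun n => z (n + 1)) + y 0 z
            = ∑ k ∈ Finset.range (n + 1), y k z := fun n => by
          rw [Finset.sum_range_succ']
          simp only [hyT]
        constructor
        · intro h
          refine GrowsFaster.of_le_shift (p := 1) (C := 0) h fun n => ?_
          have := hsum n
          have : 0 ≤ y 0 z := indicator_one_nonneg _ _
          linarith
        · intro h
          refine GrowsFaster.of_le_shift (p := 0) (C := y 0 z) h fun n => ?_
          rw [add_zero, hsum, Finset.sum_range_succ]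
          have : 0 ≤ y n z := indicator_one_nonneg _ _
          linarith
      rcases herg.toPreErgodic.ae_empty_or_univ hE hinv with h | h
      · right
        have : ∀ᵐ z ∂μ.map Z, z ∉ E := by
          filter_upwards [h] with z hz hzE
          exact (Eq.mp hz hzE : z ∈ (∅ : Set (ℕ → γ)))
        exact ae_of_ae_map hZ.aemeasurable this
      · left
        have : ∀ᵐ z ∂μ.map Z, z ∈ E := by
          filter_upwards [h] with z hz
          exact (Eq.mpr hz (Set.mem_univ z) : z ∈ E)
        exact ae_of_ae_map hZ.aemeasurable this
  filter_upwards [upper B hB, upper Bᶜ hB.compl] with ω h1 h2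
  refine tendsto_average_of_upper_bounds h1 h2 ?_
  have h3 : μ.real (Z ⁻¹' B) + μ.real (Z ⁻¹' Bᶜ) = 1 := by
    rw [Set.preimage_compl, probReal_compl_eq_one_sub (hZ hB)]
    ring
  rw [h3]
  refine tendsto_const_nhds.congr' ?_
  filter_upwards [eventually_gt_atTop 0] with N hN
  have hN' : (N : ℝ) ≠ 0 := by exact_mod_cast hN.ne'
  rw [← Finset.sum_add_distrib]
  have h4 : ∀ z, B.indicator (fun _ => (1 : ℝ)) z + Bᶜ.indicator (fun _ => (1 : ℝ)) z = 1 :=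
    fun z => congrFun (Set.indicator_self_add_compl B fun _ => (1 : ℝ)) z
  simp only [h4, Finset.sum_const, Finset.card_range, nsmul_eq_mul, mul_one]
  field_simp

/-! ### Laws on the half-line and the candidate law of the AoI. -/

lemma IsNonnegLaw.cdf_of_neg {ν : Measure ℝ} (hν : IsNonnegLaw ν) {x : ℝ} (hx : x < 0) :
    cdf ν x = 0 := by
  have := hν.isProbability
  rw [cdf_eq_real, measureReal_def]
  have : ν (Set.Iic x) = 0 := by
    refine measure_mono_null (fun y hy => ?_) (ae_iff.1 hν.nonneg)
    exact not_le.2 (lt_of_le_of_lt hy hx)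
  rw [this, ENNReal.toReal_zero]

lemma isNonnegLaw_map {Ω : Type*} [MeasurableSpace Ω] {μ : Measure Ω} [IsProbabilityMeasure μ]
    {Y : Ω → ℝ} (hY : AEMeasurable Y μ) (h : ∀ᵐ ω ∂μ, 0 ≤ Y ω) : IsNonnegLaw (μ.map Y) :=
  ⟨Measure.isProbabilityMeasure_map hY, (ae_map_iff hY measurableSet_Ici).2 h⟩

/-- An asymptotic frequency distribution is unique. -/
theorem IsFrequencyLaw.unique {Ω : Type*} [MeasurableSpace Ω] {μ : Measure Ω}
    [IsProbabilityMeasure μ] {Y : ℕ → Ω → ℝ} {ν ν' : Measure ℝ} (h : IsFrequencyLaw μ Y ν)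
    (h' : IsFrequencyLaw μ Y ν') (hν : IsNonnegLaw ν) (hν' : IsNonnegLaw ν') : ν = ν' := by
  have := hν.isProbability
  have := hν'.isProbability
  obtain ⟨ω, h1, h2⟩ := (h.and h').exists
  refine Measure.eq_of_cdf _ _ (StieltjesFunction.ext fun x => ?_)
  rcases lt_or_ge x 0 with hx | hx
  · rw [hν.cdf_of_neg hx, hν'.cdf_of_neg hx]
  · exact tendsto_nhds_unique (h1 x hx) (h2 x hx)

/-- The measure on the half-line with density `lam * (F_D - F_P)`, where `F_D`, `F_P` are the
distribution functions of `PD` and `PP`. -/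
def aoiLaw (lam : ℝ) (PD PP : Measure ℝ) : Measure ℝ :=
  (volume.restrict (Set.Ici 0)).withDensity
    (fun x => ENNReal.ofReal (lam * (cdf PD x - cdf PP x)))

lemma measurable_cdf (ν : Measure ℝ) : Measurable (cdf ν) := (monotone_cdf ν).measurable

lemma aoiLaw_nonneg (lam : ℝ) (PD PP : Measure ℝ) : ∀ᵐ x ∂aoiLaw lam PD PP, 0 ≤ x :=
  (withDensity_absolutelyContinuous _ _).ae_le (ae_restrict_mem measurableSet_Ici)

lemma aoiLaw_Iic_of_neg (lam : ℝ) (PD PP : Measure ℝ) {x : ℝ} (hx : x < 0) :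
    aoiLaw lam PD PP (Set.Iic x) = 0 := by
  refine measure_mono_null (fun y hy => ?_) (ae_iff.1 (aoiLaw_nonneg lam PD PP))
  exact not_le.2 (lt_of_le_of_lt hy hx)

lemma intervalIntegrable_cdf (ν : Measure ℝ) (a b : ℝ) :
    IntervalIntegrable (cdf ν) volume a b :=
  intervalIntegrable_of_mem_unit (measurable_cdf ν) (cdf_nonneg ν) (cdf_le_one ν) a b

lemma aoiLaw_Iic {lam : ℝ} {PD PP : Measure ℝ}
    (h : ∀ x, 0 ≤ lam * (cdf PD x - cdf PP x)) {x : ℝ} (hx : 0 ≤ x) :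
    aoiLaw lam PD PP (Set.Iic x)
      = ENNReal.ofReal (lam * ∫ u in (0 : ℝ)..x, (cdf PD u - cdf PP u)) := by
  rw [aoiLaw, withDensity_apply _ measurableSet_Iic, Measure.restrict_restrict measurableSet_Iic,
    Set.Iic_inter_Ici, ← intervalIntegral.integral_const_mul,
    intervalIntegral.integral_of_le hx, ← integral_Icc_eq_integral_Ioc,
    ofReal_integral_eq_lintegral_ofReal]
  · rw [← IntegrableOn, integrableOn_Icc_iff_integrableOn_Ioc,
      ← intervalIntegrable_iff_integrableOn_Ioc_of_le hx]
    exact ((intervalIntegrable_cdf _ _ _).sub (intervalIntegrable_cdf _ _ _)).const_mul _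
  · exact Eventually.of_forall h

/-! ### The AoI frequencies, and stationarity with respect to updates. -/

namespace FIFOSystem

variable {Ω : Type*} [MeasurableSpace Ω] (S : FIFOSystem Ω) {μ : Measure Ω} {lam : ℝ}

lemma measurable_increments : Measurable S.increments :=
  measurable_pi_lambda _ fun n =>
    ((S.measurable_β (n + 1)).sub (S.measurable_β n)).prodMk (S.measurable_delay n)

lemma map_increments_shift (h : S.EventStationaryErgodic μ) {γ : Type*} [MeasurableSpace γ]
    {g : (ℕ → ℝ × ℝ) → γ} (hg : Measurable g) (k : ℕ) :
    μ.map (fun ω => g fun n => S.increments ω (n + k)) = μ.map (fun ω => g (S.increments ω)) := by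
  induction k with
  | zero => rfl
  | succ k ih =>
    rw [← ih]
    have hk : Measurable fun (z : ℕ → ℝ × ℝ) n => z (n + k) :=
      measurable_pi_lambda _ fun n => measurable_pi_apply (n + k)
    have hgk : Measurable fun z : ℕ → ℝ × ℝ => g fun n => z (n + k) := hg.comp hk
    have h1 : (fun ω => g fun n => S.increments ω (n + (k + 1)))
        = (fun z : ℕ → ℝ × ℝ => g fun n => z (n + k)) ∘ (fun z n => z (n + 1)) ∘ S.increments := by
      funext ω
      simp only [Function.comp, add_assoc]
    have h2 : (fun ω => g fun n => S.increments ω (n + k))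
        = (fun z : ℕ → ℝ × ℝ => g fun n => z (n + k)) ∘ S.increments := rfl
    rw [h1, h2, ← Measure.map_map hgk (h.measurable.comp S.measurable_increments),
      ← Measure.map_map h.measurable S.measurable_increments, h.map_eq,
      Measure.map_map hgk S.measurable_increments]

variable [IsProbabilityMeasure μ]

/-- The limits are not random, so a single path on which both frequencies converge suffices. -/
lemma cdf_peak_le_cdf_delay {PD PP : Measure ℝ} (hD : IsFrequencyLaw μ S.delay PD)
    (hP : IsFrequencyLaw μ S.peak PP) (hPP : IsNonnegLaw PP) (x : ℝ) : cdf PP x ≤ cdf PD x := by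
  rcases lt_or_ge x 0 with hx | hx
  · rw [hPP.cdf_of_neg hx]; exact cdf_nonneg _ _
  · obtain ⟨ω, h1, h2⟩ := (hD.and hP).exists
    exact S.le_of_tendsto_frequencies (h1 x hx) (h2 x hx)

theorem isTimeFrequencyLaw_aoiLaw (hlam : 0 < lam) (hdep : S.HasDepartureRate μ lam)
    {PD PP : Measure ℝ} (hD : IsFrequencyLaw μ S.delay PD) (hP : IsFrequencyLaw μ S.peak PP)
    (hPP : IsNonnegLaw PP) [IsProbabilityMeasure (aoiLaw lam PD PP)] :
    S.IsTimeFrequencyLaw μ (aoiLaw lam PD PP) := by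
  have hle := S.cdf_peak_le_cdf_delay hD hP hPP
  filter_upwards [hdep, hD, hP] with ω h1 h2 h3 x hx
  have := S.tendsto_timeAverage hlam h1 h2 h3 hx
  rw [cdf_eq_real, measureReal_def,
    aoiLaw_Iic (fun x => mul_nonneg hlam.le (sub_nonneg.2 (hle x))) hx, ENNReal.toReal_ofReal]
  · exact this
  · exact mul_nonneg hlam.le (intervalIntegral.integral_nonneg hx fun u _ => sub_nonneg.2 (hle u))

/-- The frequency of `Y ≤ x` is the frequency of visits of the shifted increment sequence to `g ⁻¹'
Iic x`. -/
lemma isFrequencyLaw_of_event (h : S.EventStationaryErgodic μ) {g : (ℕ → ℝ × ℝ) → ℝ}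
    (hg : Measurable g) {Y : ℕ → Ω → ℝ}
    (hY : ∀ k ω, Y (k + 1) ω = g fun n => S.increments ω (n + k)) :
    IsFrequencyLaw μ Y (μ.map (Y 1)) := by
  refine isFrequencyLaw_of_forall_ae fun x => ?_
  have hY1 : Y 1 = g ∘ S.increments := funext fun ω => hY 0 ω
  have hm : Measurable (Y 1) := hY1 ▸ hg.comp S.measurable_increments
  have := Measure.isProbabilityMeasure_map (μ := μ) hm.aemeasurable
  filter_upwards [tendsto_frequency_of_ergodic_shift S.measurable_increments h
    (hg (measurableSet_Iic (a := x)))] with ω hω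
  rw [cdf_eq_real, map_measureReal_apply hm measurableSet_Iic, hY1, Set.preimage_comp]
  refine hω.congr fun N => ?_
  rw [sum_Icc_eq_sum_range]
  simp only [hY]
  rfl

/-- The mean inter-update time is the reciprocal of the departure rate. -/
lemma lintegral_interUpdate_of_event (hlam : 0 < lam) (hdep : S.HasDepartureRate μ lam)
    (h : S.EventStationaryErgodic μ) :
    ∫⁻ ω, ENNReal.ofReal (S.β 1 ω - S.β 0 ω) ∂μ = ENNReal.ofReal lam⁻¹ := by
  have hg : Measurable fun z : ℕ → ℝ × ℝ => ENNReal.ofReal (z 0).1 :=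
    ENNReal.measurable_ofReal.comp (measurable_fst.comp (measurable_pi_apply 0))
  -- The averages telescope to `β n / n`, whose limit is the reciprocal of the departure rate.
  refine lintegral_eq_of_tendsto_average
    (Y := fun k ω => ENNReal.ofReal (S.β (k + 1) ω - S.β k ω)) (fun n => ?_) (fun n => ?_) ?_
  · exact ENNReal.measurable_ofReal.comp ((S.measurable_β (n + 1)).sub (S.measurable_β n))
  · have := S.map_increments_shift h hg n
    simpa only [increments, zero_add] using this
  · filter_upwards [hdep] with ω hω
    have h1 := (S.tendsto_div_β hlam hω).inv₀ hlam.ne'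
    refine (ENNReal.tendsto_ofReal h1).congr' ?_
    filter_upwards [eventually_gt_atTop 0] with n hn
    have hn' : (0 : ℝ) < n := by exact_mod_cast hn
    rw [← ENNReal.ofReal_sum_of_nonneg (fun k _ => sub_nonneg.2 (S.β_lt k ω).le),
      Finset.sum_range_sub (fun k => S.β k ω), S.β_zero, sub_zero, inv_div,
      ENNReal.ofReal_div_of_pos hn', ENNReal.ofReal_natCast]

/-- The density at `u` is `lam` times the probability of `D_0 ≤ u < A_peak,1`. By Fubini its
integral is `lam` times the mean of `A_peak,1 - D_0 = β_1 - β_0`. Delay `0` is paired with peak `1`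
because they bound the same cycle. -/
lemma aoiLaw_univ_of_event (hlam : 0 < lam) (hdep : S.HasDepartureRate μ lam)
    (h : S.EventStationaryErgodic μ) :
    aoiLaw lam (μ.map (S.delay 0)) (μ.map (S.peak 1)) Set.univ = 1 := by
  have hmD := S.measurable_delay 0
  have hmP := S.measurable_peak 1
  have := Measure.isProbabilityMeasure_map (μ := μ) hmD.aemeasurable
  have := Measure.isProbabilityMeasure_map (μ := μ) hmP.aemeasurable
  let E : Set (ℝ × Ω) := {q | S.delay 0 q.2 ≤ q.1 ∧ q.1 < S.peak 1 q.2}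
  have hE : MeasurableSet E :=
    (measurableSet_le (hmD.comp measurable_snd) measurable_fst).inter
      (measurableSet_lt measurable_fst (hmP.comp measurable_snd))
  have h1 : ∀ u, ENNReal.ofReal (lam * (cdf (μ.map (S.delay 0)) u - cdf (μ.map (S.peak 1)) u))
      = ENNReal.ofReal lam * μ (Prod.mk u ⁻¹' E) := by
    intro u
    rw [ENNReal.ofReal_mul hlam.le, ENNReal.ofReal_sub _ (cdf_nonneg _ _), ofReal_cdf, ofReal_cdf,
      Measure.map_apply hmD measurableSet_Iic, Measure.map_apply hmP measurableSet_Iic,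
      ← measure_sdiff _ (hmP measurableSet_Iic).nullMeasurableSet (measure_ne_top _ _)]
    · congr 2
      ext ω
      simp [E]
    · intro ω hω
      exact (S.delay_lt_peak_succ 0 ω).le.trans hω
  have h2 : ∀ ω, (volume.restrict (Set.Ici (0 : ℝ))) ((fun u => (u, ω)) ⁻¹' E)
      = ENNReal.ofReal (S.β 1 ω - S.β 0 ω) := by
    intro ω
    have h3 : (fun u => (u, ω)) ⁻¹' E = Set.Ico (S.delay 0 ω) (S.peak 1 ω) := rfl
    rw [h3, Measure.restrict_apply measurableSet_Ico, Set.inter_eq_left.2, Real.volume_Ico]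
    · congr 1
      simp only [peak, delay]
      ring
    · intro u hu
      exact (S.delay_nonneg 0 ω).trans hu.1
  rw [aoiLaw, withDensity_apply _ MeasurableSet.univ, Measure.restrict_univ]
  simp only [h1]
  rw [lintegral_const_mul _ (measurable_measure_prodMk_left hE), ← Measure.prod_apply hE,
    Measure.prod_apply_symm hE]
  simp only [h2]
  rw [S.lintegral_interUpdate_of_event hlam hdep h, ← ENNReal.ofReal_mul hlam.le,
    mul_inv_cancel₀ hlam.ne', ENNReal.ofReal_one]

/-- The stationary laws of a system that is stationary with respect to updates. -/
theorem exists_laws_of_event (hlam : 0 < lam) (hdep : S.HasDepartureRate μ lam)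
    (h : S.EventStationaryErgodic μ) :
    ∃ PD PP : Measure ℝ, IsNonnegLaw PD ∧ IsNonnegLaw PP ∧ IsFrequencyLaw μ S.delay PD ∧
      IsFrequencyLaw μ S.peak PP ∧ IsProbabilityMeasure (aoiLaw lam PD PP) ∧
      (∀ n, 1 ≤ n → μ.map (S.delay n) = PD) ∧ (∀ n, 1 ≤ n → μ.map (S.peak n) = PP) := by
  have hg0 : Measurable fun z : ℕ → ℝ × ℝ => (z 0).2 :=
    measurable_snd.comp (measurable_pi_apply 0)
  have hgD : Measurable fun z : ℕ → ℝ × ℝ => (z 1).2 :=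
    measurable_snd.comp (measurable_pi_apply 1)
  have hgP : Measurable fun z : ℕ → ℝ × ℝ => (z 0).1 + (z 0).2 :=
    (measurable_fst.comp (measurable_pi_apply 0)).add hg0
  have hD : ∀ k ω, S.delay (k + 1) ω
      = (fun z : ℕ → ℝ × ℝ => (z 1).2) fun n => S.increments ω (n + k) := by
    intro k ω
    simp only [increments, add_comm]
  have hP : ∀ k ω, S.peak (k + 1) ω
      = (fun z : ℕ → ℝ × ℝ => (z 0).1 + (z 0).2) fun n => S.increments ω (n + k) := by
    intro k ω
    simp only [increments, zero_add, peak, delay, Nat.add_sub_cancel]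
    ring
  have hlawD : ∀ n, μ.map (S.delay n) = μ.map (S.delay 0) := by
    intro n
    have := S.map_increments_shift h hg0 n
    simpa only [increments, zero_add] using this
  refine ⟨μ.map (S.delay 1), μ.map (S.peak 1),
    isNonnegLaw_map (S.measurable_delay 1).aemeasurable (Eventually.of_forall (S.delay_nonneg 1)),
    isNonnegLaw_map (S.measurable_peak 1).aemeasurable
      (Eventually.of_forall (S.peak_nonneg le_rfl)),
    S.isFrequencyLaw_of_event h hgD hD, S.isFrequencyLaw_of_event h hgP hP, ⟨?_⟩,
    fun n _ => by rw [hlawD n, hlawD 1], fun n hn => ?_⟩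
  · rw [hlawD 1]
    exact S.aoiLaw_univ_of_event hlam hdep h
  · obtain ⟨k, rfl⟩ := Nat.exists_eq_add_of_le' hn
    have h1 := S.map_increments_shift h hgP k
    rw [show S.peak (k + 1) = _ from funext (hP k), h1]
    exact congrArg (μ.map ·) (funext fun ω => (hP 0 ω).symm)

end FIFOSystem

/-! ### Additive functions and counts of marked points. -/

/-- An additive function on the half-line with values in `[0, ∞]` is linear if it is finite
at `1`. -/
lemma eq_ofReal_mul_of_additive {φ : ℝ → ENNReal}
    (hadd : ∀ s t, 0 ≤ s → 0 ≤ t → φ (s + t) = φ s + φ t) (h1 : φ 1 ≠ ⊤) {t : ℝ} (ht : 0 ≤ t) :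
    φ t = ENNReal.ofReal t * φ 1 := by
  have hmono : ∀ s t, 0 ≤ s → s ≤ t → φ s ≤ φ t := by
    intro s t hs hst
    have := hadd s (t - s) hs (sub_nonneg.2 hst)
    rw [add_sub_cancel] at this
    rw [this]
    exact le_self_add
  have h0 : φ 0 = 0 := by
    have := hadd 0 1 le_rfl zero_le_one
    rw [zero_add] at this
    refine (ENNReal.add_left_inj h1).1 ?_
    rw [zero_add]
    exact this.symm
  have hnat : ∀ (n : ℕ) (s : ℝ), 0 ≤ s → φ (n * s) = n * φ s := by
    intro n s hs
    induction n with
    | zero => simp [h0]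
    | succ n ih =>
      push_cast
      rw [add_mul, one_mul, hadd _ _ (by positivity) hs, ih, add_mul, one_mul]
  have hnat1 : ∀ n : ℕ, φ n = n * φ 1 := fun n => by
    have := hnat n 1 zero_le_one
    rwa [mul_one] at this
  have hfin : ∀ s, 0 ≤ s → φ s ≠ ⊤ := by
    intro s hs
    obtain ⟨n, hn⟩ := exists_nat_ge s
    refine ne_top_of_le_ne_top ?_ (hmono s n hs hn)
    rw [hnat1]
    exact ENNReal.mul_ne_top (ENNReal.natCast_ne_top n) h1
  -- Since `n * t` lies between consecutive integers, `n φ(t)` differs from `n t φ(1)` by at most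
  -- `φ(1)`; large `n` forces equality.
  have key : ∀ n : ℕ, |(φ t).toReal - t * (φ 1).toReal| * n ≤ (φ 1).toReal := by
    intro n
    have hnt : 0 ≤ (n : ℝ) * t := by positivity
    have e1 := congrArg ENNReal.toReal (hnat n t ht)
    rw [ENNReal.toReal_mul, ENNReal.toReal_natCast] at e1
    have e2 := ENNReal.toReal_mono (hfin _ hnt)
      (hmono (⌊(n : ℝ) * t⌋₊ : ℝ) _ (by positivity) (Nat.floor_le hnt))
    rw [hnat1, ENNReal.toReal_mul, ENNReal.toReal_natCast, e1] at e2
    have e3 := ENNReal.toReal_mono (hfin _ (by positivity))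
      (hmono _ ((⌊(n : ℝ) * t⌋₊ + 1 : ℕ) : ℝ) hnt (by
        push_cast; exact (Nat.lt_floor_add_one _).le))
    rw [hnat1, ENNReal.toReal_mul, ENNReal.toReal_natCast, e1] at e3
    push_cast at e3
    have f1 := Nat.floor_le hnt
    have f2 := Nat.lt_floor_add_one ((n : ℝ) * t)
    have f0 : 0 ≤ (φ 1).toReal := ENNReal.toReal_nonneg
    have g1 := mul_le_mul_of_nonneg_right f1 f0
    have g2 := mul_le_mul_of_nonneg_right f2.le f0
    rw [← abs_of_nonneg (Nat.cast_nonneg (α := ℝ) n), ← abs_mul, abs_le]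
    constructor <;> nlinarith
  have hreal : (φ t).toReal = t * (φ 1).toReal := by
    by_contra hne
    have hpos : 0 < |(φ t).toReal - t * (φ 1).toReal| := abs_pos.2 (sub_ne_zero.2 hne)
    obtain ⟨n, hn⟩ := exists_nat_gt ((φ 1).toReal / |(φ t).toReal - t * (φ 1).toReal|)
    rw [div_lt_iff₀ hpos] at hn
    have := key n
    linarith
  rw [← ENNReal.ofReal_toReal (hfin t ht), hreal, ENNReal.ofReal_mul ht, ENNReal.ofReal_toReal h1]

/-- The number of points `n ≥ 1` of a marked point process that lie in `(s, t]` and have their mark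
in `C`, where `mark n` is the mark of the point `n + 1`. -/
def markCount (mark : ℕ → (ℕ → ℝ × ℝ) → ℝ) (C : Set ℝ) (s t : ℝ) (z : ℕ → ℝ × ℝ) : ENNReal :=
  ∑' n : ℕ, {z : ℕ → ℝ × ℝ | s < (z (n + 1)).1 ∧ (z (n + 1)).1 ≤ t ∧ mark n z ∈ C}.indicator 1 z

lemma measurableSet_markCount {mark : ℕ → (ℕ → ℝ × ℝ) → ℝ} (hm : ∀ n, Measurable (mark n))
    {C : Set ℝ} (hC : MeasurableSet C) (s t : ℝ) (n : ℕ) : MeasurableSet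
      {z : ℕ → ℝ × ℝ | s < (z (n + 1)).1 ∧ (z (n + 1)).1 ≤ t ∧ mark n z ∈ C} := by
  have h1 : Measurable fun z : ℕ → ℝ × ℝ => (z (n + 1)).1 :=
    measurable_fst.comp (measurable_pi_apply (n + 1))
  exact (measurableSet_lt measurable_const h1).inter
    ((measurableSet_le h1 measurable_const).inter (hm n hC))

lemma measurable_markCount {mark : ℕ → (ℕ → ℝ × ℝ) → ℝ} (hm : ∀ n, Measurable (mark n))
    {C : Set ℝ} (hC : MeasurableSet C) (s t : ℝ) : Measurable (markCount mark C s t) :=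
  Measurable.tsum fun n => measurable_one.indicator (measurableSet_markCount hm hC s t n)

lemma markCount_add {mark : ℕ → (ℕ → ℝ × ℝ) → ℝ} {C : Set ℝ} {r s t : ℝ} (hrs : r ≤ s)
    (hst : s ≤ t) (z : ℕ → ℝ × ℝ) :
    markCount mark C r s z + markCount mark C s t z = markCount mark C r t z := by
  rw [markCount, markCount, markCount, ← ENNReal.tsum_add]
  refine tsum_congr fun n => ?_
  classical
  simp only [Set.indicator_apply, Set.mem_ofPred_eq, Pi.one_apply]
  by_cases hC : mark n z ∈ C
  · by_cases h1 : (z (n + 1)).1 ≤ s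
    · have h2 : ¬ s < (z (n + 1)).1 := not_lt.2 h1
      have h3 : (z (n + 1)).1 ≤ t := h1.trans hst
      simp [hC, h1, h2, h3]
    · have h2 : s < (z (n + 1)).1 := not_le.1 h1
      have h3 : r < (z (n + 1)).1 := hrs.trans_lt h2
      simp [hC, h1, h2, h3]
  · simp [hC]

lemma markCount_mono {mark : ℕ → (ℕ → ℝ × ℝ) → ℝ} {C : Set ℝ} {r s t : ℝ} (hrs : r ≤ s)
    (hst : s ≤ t) (z : ℕ → ℝ × ℝ) : markCount mark C r s z ≤ markCount mark C r t z := by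
  rw [← markCount_add hrs hst z]
  exact le_self_add

/-! ### Marked updates and Palm laws under stationarity in time. -/

namespace FIFOSystem

variable {Ω : Type*} [MeasurableSpace Ω] (S : FIFOSystem Ω)

/-- Non-negative marks of the updates that are functionals of the marked point process and do not
depend on the choice of the time origin. -/
structure IsMark (mark : ℕ → (ℕ → ℝ × ℝ) → ℝ) : Prop where
  measurable : ∀ n, Measurable (mark n)
  shift : ∀ ω, Tendsto (fun n => S.β n ω) atTop atTop → ∀ t, 0 ≤ t → ∀ k,
    mark k (S.markedFrom t ω) = mark (S.updates t ω + k) (S.marked ω)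
  nonneg : ∀ n ω, 0 ≤ mark n (S.marked ω)

lemma isMark_delay : S.IsMark fun n z => (z (n + 1)).2 where
  measurable n := measurable_snd.comp (measurable_pi_apply (n + 1))
  shift _ _ _ _ _ := rfl
  nonneg n ω := S.delay_nonneg (n + 1) ω

lemma isMark_peak : S.IsMark fun n z => (z (n + 1)).1 - (z n).1 + (z n).2 where
  measurable n := ((measurable_fst.comp (measurable_pi_apply (n + 1))).sub
    (measurable_fst.comp (measurable_pi_apply n))).add (measurable_snd.comp (measurable_pi_apply n))
  shift ω _ t _ k := by
    cases k with
    -- Here the origin's mark matters: with `M` updates by time `t`, `(β (M+1) - t) + A_t` is the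
    -- true peak `β (M+1) - α M`.
    | zero => simp [markedFrom, marked, aoi, timeStamp, delay]
    | succ k =>
      simp only [markedFrom, marked, if_neg (Nat.succ_ne_zero _), ← add_assoc]
      ring
  nonneg n ω := by
    have h1 := S.delay_nonneg n ω
    have h2 := S.β_lt n ω
    simp only [marked]
    linarith

variable {S} {mark : ℕ → (ℕ → ℝ × ℝ) → ℝ} {C : Set ℝ} {ω : Ω}

/-- The shift drops the first `M_r` updates. These occur no later than `r ≤ s + r`, hence contribute
nothing on the right. -/
lemma markCount_markedFrom (hm : S.IsMark mark) (hβ : Tendsto (fun n => S.β n ω) atTop atTop)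
    {r s t : ℝ} (hr : 0 ≤ r) (hs : 0 ≤ s) :
    markCount mark C s t (S.markedFrom r ω) = markCount mark C (s + r) (t + r) (S.marked ω) := by
  set M := S.updates r ω with hM
  have key : ∀ f : ℕ → ENNReal, ∑ n ∈ Finset.range M, f n + ∑' n, f (n + M) = ∑' n, f n :=
    fun f => Summable.sum_add_tsum_nat_add' ENNReal.summable
  conv_rhs => rw [markCount, ← key]
  rw [markCount, Finset.sum_eq_zero, zero_add]
  · refine tsum_congr fun n => ?_
    classical
    simp only [Set.indicator_apply, Set.mem_ofPred_eq, hm.shift ω hβ r hr, ← hM]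
    have h1 : (S.markedFrom r ω (n + 1)).1 = S.β (n + M + 1) ω - r := by
      simp only [markedFrom, if_neg (Nat.succ_ne_zero _), ← hM]
      rw [show M + (n + 1) = n + M + 1 by ring]
    have h2 : (S.marked ω (n + M + 1)).1 = S.β (n + M + 1) ω := rfl
    simp only [h1, h2, lt_sub_iff_add_lt, sub_le_iff_le_add, add_comm M n, Pi.one_apply]
  · intro n hn
    refine Set.indicator_of_notMem (fun h => ?_) _
    have h1 : s + r < S.β (n + 1) ω := h.1
    have h2 := (le_updates_iff hβ hr (n + 1)).1 (Finset.mem_range.1 hn)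
    linarith

lemma markCount_eq_sum (hβ : Tendsto (fun n => S.β n ω) atTop atTop) {t : ℝ} (ht : 0 ≤ t) :
    markCount mark C 0 t (S.marked ω)
      = ENNReal.ofReal (∑ n ∈ Finset.range (S.updates t ω),
        C.indicator (fun _ => (1 : ℝ)) (mark n (S.marked ω))) := by
  have hpos : ∀ n, 0 < S.β (n + 1) ω := fun n => (S.β_nonneg n ω).trans_lt (S.β_lt n ω)
  rw [markCount, tsum_eq_sum (s := Finset.range (S.updates t ω)),
    ENNReal.ofReal_sum_of_nonneg fun n _ => indicator_one_nonneg _ _]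
  · refine Finset.sum_congr rfl fun n hn => ?_
    have h2 := (le_updates_iff hβ ht (n + 1)).1 (Finset.mem_range.1 hn)
    have h3 : (S.marked ω (n + 1)).1 = S.β (n + 1) ω := rfl
    by_cases hC : mark n (S.marked ω) ∈ C
    · simp [h3, hC, h2, hpos n]
    · simp [hC]
  · intro n hn
    refine Set.indicator_of_notMem (fun h => hn ?_) _
    exact Finset.mem_range.2 ((le_updates_iff hβ ht (n + 1)).2 h.2.1)

lemma markCount_ne_top (hβ : Tendsto (fun n => S.β n ω) atTop atTop) {s t : ℝ} (hs : 0 ≤ s)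
    (hst : s ≤ t) : markCount mark C s t (S.marked ω) ≠ ⊤ := by
  refine ne_top_of_le_ne_top (b := markCount mark C 0 t (S.marked ω)) ?_ ?_
  · rw [markCount_eq_sum hβ (hs.trans hst)]
    exact ENNReal.ofReal_ne_top
  · rw [← markCount_add hs hst]
    exact le_add_self

lemma sum_markCount (z : ℕ → ℝ × ℝ) (t : ℝ) (n : ℕ) :
    ∑ k ∈ Finset.range n, markCount mark C (k + t) (k + 1 + t) z
      = markCount mark C t (n + t) z := by
  induction n with
  | zero =>
    have : ∀ y : ℝ, t < y → y ≤ t → False := fun y h1 h2 => absurd h2 (not_le.2 h1)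
    symm
    simp only [Finset.range_zero, Finset.sum_empty, Nat.cast_zero, zero_add, markCount,
      ENNReal.tsum_eq_zero]
    exact fun n => Set.indicator_of_notMem (fun h => this _ h.1 h.2.1) _
  | succ n ih =>
    rw [Finset.sum_range_succ, ih, markCount_add (by have := n.cast_nonneg (α := ℝ); linarith)
      (by linarith)]
    push_cast
    rfl

lemma sum_toReal_markCount (hβ : Tendsto (fun n => S.β n ω) atTop atTop) {t : ℝ} (ht : 0 ≤ t)
    (n : ℕ) :
    ∑ k ∈ Finset.range n, (markCount mark C (k + t) (k + 1 + t) (S.marked ω)).toReal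
      = (markCount mark C t (n + t) (S.marked ω)).toReal := by
  rw [← sum_markCount, ENNReal.toReal_sum]
  exact fun k _ => markCount_ne_top hβ (by positivity) (by linarith)

variable {μ : Measure Ω}

lemma lintegral_markCount (hm : S.IsMark mark) (hC : MeasurableSet C) (t : ℝ) :
    ∫⁻ ω, markCount mark C 0 t (S.marked ω) ∂μ
      = ∑' n : ℕ, μ {ω | S.β (n + 1) ω ≤ t ∧ mark n (S.marked ω) ∈ C} := by
  have hpos : ∀ n ω, 0 < S.β (n + 1) ω := fun n ω => (S.β_nonneg n ω).trans_lt (S.β_lt n ω)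
  have hms := measurableSet_markCount hm.measurable hC 0 t
  simp only [markCount]
  have hae : ∀ n, AEMeasurable (fun ω => {z : ℕ → ℝ × ℝ | 0 < (z (n + 1)).1 ∧ (z (n + 1)).1 ≤ t ∧
      mark n z ∈ C}.indicator (1 : (ℕ → ℝ × ℝ) → ENNReal) (S.marked ω)) μ := fun n =>
    ((measurable_one.indicator (hms n)).comp S.measurable_marked).aemeasurable
  rw [lintegral_tsum hae]
  refine tsum_congr fun n => ?_
  have h1 : {ω | S.β (n + 1) ω ≤ t ∧ mark n (S.marked ω) ∈ C} = S.marked ⁻¹'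
      {z : ℕ → ℝ × ℝ | 0 < (z (n + 1)).1 ∧ (z (n + 1)).1 ≤ t ∧ mark n z ∈ C} := by
    ext ω
    exact ⟨fun h => ⟨hpos n ω, h⟩, fun h => h.2⟩
  rw [h1, ← lintegral_indicator_one (S.measurable_marked (hms n))]
  rfl

variable {lam : ℝ}

lemma ae_tendsto_β (hlam : 0 < lam) (hdep : S.HasDepartureRate μ lam) :
    ∀ᵐ ω ∂μ, Tendsto (fun n => S.β n ω) atTop atTop := by
  filter_upwards [hdep] with ω hω using S.tendsto_β_atTop hlam hω

/-- The law of the mark of a typical update. -/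
def palmLaw (S : FIFOSystem Ω) (μ : Measure Ω) (lam : ℝ) (mark : ℕ → (ℕ → ℝ × ℝ) → ℝ) :
    Measure ℝ :=
  (ENNReal.ofReal lam)⁻¹ • Measure.sum fun n : ℕ =>
    (μ.restrict {ω | S.β (n + 1) ω ≤ 1}).map fun ω => mark n (S.marked ω)

lemma palmLaw_apply (hm : S.IsMark mark) (hC : MeasurableSet C) :
    S.palmLaw μ lam mark C
      = (ENNReal.ofReal lam)⁻¹ * ∫⁻ ω, markCount mark C 0 1 (S.marked ω) ∂μ := by
  rw [palmLaw, Measure.smul_apply, smul_eq_mul, Measure.sum_apply _ hC, lintegral_markCount hm hC]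
  congr 1
  refine tsum_congr fun n => ?_
  have hmn : Measurable fun ω => mark n (S.marked ω) := (hm.measurable n).comp S.measurable_marked
  rw [Measure.map_apply hmn hC, Measure.restrict_apply (hmn hC)]
  congr 1
  ext ω
  exact and_comm

lemma lintegral_markCount_eq_palmLaw (hlam : 0 < lam) (hm : S.IsMark mark)
    (hC : MeasurableSet C) : ∫⁻ ω, markCount mark C 0 1 (S.marked ω) ∂μ
      = ENNReal.ofReal lam * S.palmLaw μ lam mark C := by
  rw [palmLaw_apply hm hC, ← mul_assoc, ENNReal.mul_inv_cancel (by simpa using hlam)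
    ENNReal.ofReal_ne_top, one_mul]

variable [IsProbabilityMeasure μ]

/-- The image of `μ` under a map that is not almost everywhere measurable is `0` by convention,
whereas stationarity equates it with a probability measure. -/
lemma aemeasurable_markedFrom (h : S.TimeStationaryErgodic μ) {t : ℝ} (ht : 0 ≤ t) :
    AEMeasurable (S.markedFrom t) μ := by
  by_contra hn
  have h1 := h.stationary t ht
  rw [Measure.map_of_not_aemeasurable hn] at h1
  have := Measure.isProbabilityMeasure_map (μ := μ) S.measurable_marked.aemeasurable
  exact IsProbabilityMeasure.ne_zero _ h1.symm

lemma map_comp_markedFrom (h : S.TimeStationaryErgodic μ) {γ : Type*} [MeasurableSpace γ]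
    {g : (ℕ → ℝ × ℝ) → γ} (hg : Measurable g) {t : ℝ} (ht : 0 ≤ t) :
    μ.map (fun ω => g (S.markedFrom t ω)) = μ.map (fun ω => g (S.marked ω)) := by
  have h1 := AEMeasurable.map_map_of_aemeasurable hg.aemeasurable (aemeasurable_markedFrom h ht)
  have h2 := Measure.map_map (μ := μ) hg S.measurable_marked
  rw [h.stationary t ht, h2] at h1
  exact h1.symm

lemma map_markCount_shift (hlam : 0 < lam) (hdep : S.HasDepartureRate μ lam)
    (h : S.TimeStationaryErgodic μ) (hm : S.IsMark mark) (hC : MeasurableSet C) {r s t : ℝ}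
    (hr : 0 ≤ r) (hs : 0 ≤ s) :
    μ.map (fun ω => markCount mark C (s + r) (t + r) (S.marked ω))
      = μ.map (fun ω => markCount mark C s t (S.marked ω)) := by
  rw [← map_comp_markedFrom h (measurable_markCount hm.measurable hC s t) hr]
  refine Measure.map_congr ?_
  filter_upwards [ae_tendsto_β hlam hdep] with ω hω
  exact (markCount_markedFrom hm hω hr hs).symm

/-- The counts in unit intervals are identically distributed and their averages are `M_n / n`, so
the departure rate determines their mean. This also shows that the mean is finite. -/
lemma lintegral_markCount_univ (hlam : 0 < lam) (hdep : S.HasDepartureRate μ lam)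
    (h : S.TimeStationaryErgodic μ) (hm : S.IsMark mark) :
    ∫⁻ ω, markCount mark Set.univ 0 1 (S.marked ω) ∂μ = ENNReal.ofReal lam := by
  have := lintegral_eq_of_tendsto_average (μ := μ)
    (Y := fun (k : ℕ) ω => markCount mark Set.univ (k + 0) (k + 1 + 0) (S.marked ω))
    (fun k => (measurable_markCount hm.measurable .univ _ _).comp S.measurable_marked)
    (fun k => ?_) (c := ENNReal.ofReal lam) ?_
  · simpa using this
  · have := map_markCount_shift hlam hdep h hm .univ (k.cast_nonneg (α := ℝ)) le_rfl (t := 1)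
    simpa [add_comm] using this
  · filter_upwards [hdep] with ω hω
    have hβ := S.tendsto_β_atTop hlam hω
    refine (ENNReal.tendsto_ofReal (hω.comp tendsto_natCast_atTop_atTop)).congr' ?_
    filter_upwards [eventually_gt_atTop 0] with n hn
    have hn' : (0 : ℝ) < n := by exact_mod_cast hn
    rw [sum_markCount, add_zero, markCount_eq_sum hβ hn'.le]
    simp [ENNReal.ofReal_div_of_pos hn']

lemma lintegral_markCount_ne_top (hlam : 0 < lam) (hdep : S.HasDepartureRate μ lam)
    (h : S.TimeStationaryErgodic μ) (hm : S.IsMark mark) :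
    ∫⁻ ω, markCount mark C 0 1 (S.marked ω) ∂μ ≠ ⊤ := by
  refine ne_top_of_le_ne_top (ENNReal.ofReal_ne_top (r := lam)) ?_
  rw [← lintegral_markCount_univ hlam hdep h hm]
  refine lintegral_mono fun ω => ENNReal.tsum_le_tsum fun n => ?_
  refine Set.indicator_le_indicator_of_subset ?_ (fun _ => zero_le_one) _
  exact fun z hz => ⟨hz.1, hz.2.1, Set.mem_univ _⟩

/-- The mean number of marked updates is linear in time. -/
lemma lintegral_markCount_linear (hlam : 0 < lam) (hdep : S.HasDepartureRate μ lam)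
    (h : S.TimeStationaryErgodic μ) (hm : S.IsMark mark) (hC : MeasurableSet C) {t : ℝ}
    (ht : 0 ≤ t) :
    ∫⁻ ω, markCount mark C 0 t (S.marked ω) ∂μ
      = ENNReal.ofReal t * ∫⁻ ω, markCount mark C 0 1 (S.marked ω) ∂μ := by
  have hmeas : ∀ s t, Measurable fun ω => markCount mark C s t (S.marked ω) := fun s t =>
    (measurable_markCount hm.measurable hC s t).comp S.measurable_marked
  -- Split `(0, s + t]` at `s`; stationarity moves the second piece to `(0, t]`.
  refine eq_ofReal_mul_of_additive
    (φ := fun t => ∫⁻ ω, markCount mark C 0 t (S.marked ω) ∂μ) (fun s t hs ht => ?_)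
    (lintegral_markCount_ne_top hlam hdep h hm) ht
  have h1 : ∫⁻ ω, markCount mark C s (s + t) (S.marked ω) ∂μ
      = ∫⁻ ω, markCount mark C 0 t (S.marked ω) ∂μ := by
    have h2 := map_markCount_shift hlam hdep h hm hC hs le_rfl (t := t)
    rw [zero_add, add_comm t s] at h2
    have h3 : ∀ {f : Ω → ENNReal}, Measurable f → ∫⁻ ω, f ω ∂μ = ∫⁻ y, y ∂μ.map f :=
      fun hf => (lintegral_map measurable_id hf).symm
    rw [h3 (hmeas _ _), h2, ← h3 (hmeas _ _)]
  rw [← h1, ← lintegral_add_left (hmeas _ _)]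
  refine lintegral_congr fun ω => ?_
  exact (markCount_add hs (by linarith) _).symm

lemma isNonnegLaw_palmLaw (hlam : 0 < lam) (hdep : S.HasDepartureRate μ lam)
    (h : S.TimeStationaryErgodic μ) (hm : S.IsMark mark) :
    IsNonnegLaw (S.palmLaw μ lam mark) := by
  refine ⟨⟨?_⟩, ?_⟩
  · rw [palmLaw_apply hm .univ, lintegral_markCount_univ hlam hdep h hm,
      ENNReal.inv_mul_cancel (by simpa using hlam) ENNReal.ofReal_ne_top]
  · have hms : MeasurableSet {x : ℝ | ¬ 0 ≤ x} := (measurableSet_Ici (a := (0 : ℝ))).compl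
    rw [ae_iff, palmLaw_apply hm hms, lintegral_markCount hm hms]
    have : ∀ n, {ω | S.β (n + 1) ω ≤ 1 ∧ mark n (S.marked ω) ∈ {x : ℝ | ¬ 0 ≤ x}} = ∅ := by
      intro n
      ext ω
      simpa using fun _ => hm.nonneg n ω
    simp only [this, measure_empty, tsum_zero, mul_zero]

/-- The Palm formula: the mean number of updates in `(0, t]` with mark in `C`. -/
lemma tsum_measure_eq_palmLaw (hlam : 0 < lam) (hdep : S.HasDepartureRate μ lam)
    (h : S.TimeStationaryErgodic μ) (hm : S.IsMark mark) (hC : MeasurableSet C) {t : ℝ}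
    (ht : 0 ≤ t) :
    ∑' n : ℕ, μ {ω | S.β (n + 1) ω ≤ t ∧ mark n (S.marked ω) ∈ C}
      = ENNReal.ofReal (lam * t) * S.palmLaw μ lam mark C := by
  rw [← lintegral_markCount hm hC, lintegral_markCount_linear hlam hdep h hm hC ht,
    lintegral_markCount_eq_palmLaw hlam hm hC, mul_comm lam, ENNReal.ofReal_mul ht, mul_assoc]

end FIFOSystem

/-! ### Ergodic limits under stationarity in time. -/

namespace FIFOSystem

variable {Ω : Type*} [MeasurableSpace Ω] {S : FIFOSystem Ω} {μ : Measure Ω}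
  [IsProbabilityMeasure μ] {lam : ℝ} {mark : ℕ → (ℕ → ℝ × ℝ) → ℝ} {C : Set ℝ}

/-- The counts in `(k, k+1]` form a stationary sequence with mean `lam` times the Palm probability
of `C`. Their growth events are invariant under all time shifts, hence trivial by ergodicity. -/
lemma eventually_markCount_le (hlam : 0 < lam) (hdep : S.HasDepartureRate μ lam)
    (h : S.TimeStationaryErgodic μ) (hm : S.IsMark mark) (hC : MeasurableSet C) :
    ∀ᵐ ω ∂μ, ∀ m : ℕ, ∀ᶠ n : ℕ in atTop, (markCount mark C 0 n (S.marked ω)).toReal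
      ≤ (lam * (S.palmLaw μ lam mark).real C + 1 / ((m : ℝ) + 1)) * n := by
  rw [ae_all_iff]
  intro m
  let y : ℕ → (ℕ → ℝ × ℝ) → ℝ := fun k z => (markCount mark C (k + 0) (k + 1 + 0) z).toReal
  have hy : ∀ k, Measurable (y k) := fun k =>
    (measurable_markCount hm.measurable hC _ _).ennreal_toReal
  have hβ := ae_tendsto_β hlam hdep
  have hfin : ∀ᵐ ω ∂μ, markCount mark C 0 1 (S.marked ω) < ⊤ := by
    filter_upwards [hβ] with ω hω
    exact (markCount_ne_top hω le_rfl zero_le_one).lt_top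
  have hmeas : Measurable fun ω => markCount mark C 0 1 (S.marked ω) :=
    (measurable_markCount hm.measurable hC _ _).comp S.measurable_marked
  have hy0 : ∀ z, y 0 z = (markCount mark C 0 1 z).toReal := fun z => by simp [y]
  have hmean : ∫ ω, y 0 (S.marked ω) ∂μ = lam * (S.palmLaw μ lam mark).real C := by
    simp only [hy0]
    rw [integral_toReal hmeas.aemeasurable hfin, lintegral_markCount_eq_palmLaw hlam hm hC,
      ENNReal.toReal_mul, ENNReal.toReal_ofReal hlam.le, measureReal_def]
  have hyshift : ∀ ω, Tendsto (fun n => S.β n ω) atTop atTop → ∀ t, 0 ≤ t → ∀ n,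
      ∑ k ∈ Finset.range n, y k (S.markedFrom t ω)
        = (markCount mark C t (n + t) (S.marked ω)).toReal := by
    intro ω hω t ht n
    rw [← sum_toReal_markCount hω ht]
    refine Finset.sum_congr rfl fun k _ => ?_
    simp only [y, add_zero]
    rw [markCount_markedFrom hm hω ht (Nat.cast_nonneg k)]
  have hysum : ∀ ω, Tendsto (fun n => S.β n ω) atTop atTop → ∀ n,
      ∑ k ∈ Finset.range n, y k (S.marked ω) = (markCount mark C 0 n (S.marked ω)).toReal := by
    intro ω hω n
    rw [sum_toReal_markCount hω le_rfl, add_zero]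
  have main := eventually_sum_le_of_stationary (μ := μ) (Y := fun k ω => y k (S.marked ω))
    (b := lam * (S.palmLaw μ lam mark).real C + 1 / ((m : ℝ) + 1))
    (fun k => (hy k).comp S.measurable_marked) ?_ ?_ ?_ fun a => ?_
  · filter_upwards [main, hβ] with ω h1 h2
    filter_upwards [h1] with n hn
    rwa [hysum ω h2] at hn
  · have hφ : Measurable fun z k => y k z := measurable_pi_lambda _ hy
    rw [← map_comp_markedFrom h hφ zero_le_one]
    refine Measure.map_congr ?_
    filter_upwards [hβ] with ω hω
    funext k
    simp only [y, add_zero]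
    rw [markCount_markedFrom hm hω zero_le_one (Nat.cast_nonneg k)]
    push_cast
    rfl
  · simp only [hy0]
    exact integrable_toReal_of_lintegral_ne_top hmeas.aemeasurable
      (lintegral_markCount_ne_top hlam hdep h hm)
  · rw [hmean]
    have : (0 : ℝ) < 1 / ((m : ℝ) + 1) := by positivity
    linarith
  · refine h.ergodic {z | GrowsFaster a fun n => ∑ k ∈ Finset.range n, y k z}
      (measurableSet_growsFaster (fun n => Finset.measurable_sum _ fun k _ => hy k) a)
      fun t ht => ?_
    filter_upwards [hβ] with ω hω
    have hne : ∀ s, 0 ≤ s → markCount mark C 0 s (S.marked ω) ≠ ⊤ := fun s hs =>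
      markCount_ne_top hω le_rfl hs
    have hadd : ∀ n : ℕ, (markCount mark C 0 t (S.marked ω)).toReal
        + (markCount mark C t (n + t) (S.marked ω)).toReal
        = (markCount mark C 0 (n + t) (S.marked ω)).toReal := by
      intro n
      have hnt : t ≤ n + t := by have := n.cast_nonneg (α := ℝ); linarith
      rw [← markCount_add ht hnt, ENNReal.toReal_add (hne t ht) (markCount_ne_top hω ht hnt)]
    simp only [hyshift ω hω t ht, hysum ω hω]
    -- Counts in `(t, n+t]` are at most those in `(0, n+⌈t⌉]`; counts in `(0, n]` exceed them by at
    -- most the finite count in `(0, t]`.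
    constructor
    · intro hg
      refine GrowsFaster.of_le_shift (p := ⌈t⌉₊) (C := 0) hg fun n => ?_
      have h1 : (markCount mark C 0 (n + t) (S.marked ω)).toReal
          ≤ (markCount mark C 0 ((n + ⌈t⌉₊ : ℕ) : ℝ) (S.marked ω)).toReal := by
        refine ENNReal.toReal_mono (hne _ (by positivity))
          (markCount_mono (by positivity) ?_ _)
        push_cast
        have := Nat.le_ceil t
        linarith
      have h2 := hadd n
      have h3 : 0 ≤ (markCount mark C 0 t (S.marked ω)).toReal := ENNReal.toReal_nonneg
      linarith
    · intro hg
      refine GrowsFaster.of_le_shift (p := 0)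
        (C := (markCount mark C 0 t (S.marked ω)).toReal) hg fun n => ?_
      have h1 : (markCount mark C 0 n (S.marked ω)).toReal
          ≤ (markCount mark C 0 (n + t) (S.marked ω)).toReal :=
        ENNReal.toReal_mono (hne _ (by positivity))
          (markCount_mono (by positivity) (by linarith) _)
      have h2 := hadd n
      simp only [add_zero]
      linarith

/-- The counts for `C` and `Cᶜ` add up to `M_n`, whose rate is known. -/
lemma tendsto_markCount_div (hlam : 0 < lam) (hdep : S.HasDepartureRate μ lam)
    (h : S.TimeStationaryErgodic μ) (hm : S.IsMark mark) (hC : MeasurableSet C) :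
    ∀ᵐ ω ∂μ, Tendsto (fun n : ℕ => (1 / (n : ℝ)) * (markCount mark C 0 n (S.marked ω)).toReal)
      atTop (𝓝 (lam * (S.palmLaw μ lam mark).real C)) := by
  have := (isNonnegLaw_palmLaw hlam hdep h hm).isProbability
  filter_upwards [eventually_markCount_le hlam hdep h hm hC,
    eventually_markCount_le hlam hdep h hm hC.compl, hdep] with ω h1 h2 h3
  refine tendsto_average_of_upper_bounds h1 h2 ?_
  have hβ := S.tendsto_β_atTop hlam h3
  rw [← mul_add, probReal_compl_eq_one_sub hC, add_sub_cancel, mul_one]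
  refine (h3.comp tendsto_natCast_atTop_atTop).congr fun n => ?_
  have h4 : ∀ x, C.indicator (fun _ => (1 : ℝ)) x + Cᶜ.indicator (fun _ => (1 : ℝ)) x = 1 :=
    fun x => congrFun (Set.indicator_self_add_compl C fun _ => (1 : ℝ)) x
  rw [markCount_eq_sum hβ n.cast_nonneg, markCount_eq_sum hβ n.cast_nonneg,
    ENNReal.toReal_ofReal (Finset.sum_nonneg fun _ _ => indicator_one_nonneg _ _),
    ENNReal.toReal_ofReal (Finset.sum_nonneg fun _ _ => indicator_one_nonneg _ _),
    ← Finset.sum_add_distrib]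
  simp only [h4, Finset.sum_const, Finset.card_range, nsmul_eq_mul, mul_one, Function.comp]
  ring

/-- To pass from integer times to update indices, the count at `β N` is squeezed between the counts
at `⌊β N⌋` and `⌊β N⌋ + 1`. The limit `β N / N → 1 / lam` cancels the factor `lam`. -/
lemma isFrequencyLaw_palmLaw (hlam : 0 < lam) (hdep : S.HasDepartureRate μ lam)
    (h : S.TimeStationaryErgodic μ) (hm : S.IsMark mark) {Y : ℕ → Ω → ℝ}
    (hY : ∀ n ω, Y (n + 1) ω = mark n (S.marked ω)) :
    IsFrequencyLaw μ Y (S.palmLaw μ lam mark) := by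
  refine isFrequencyLaw_of_forall_ae fun x => ?_
  have := (isNonnegLaw_palmLaw hlam hdep h hm).isProbability
  filter_upwards [tendsto_markCount_div hlam hdep h hm (measurableSet_Iic (a := x)), hdep]
    with ω h1 h2
  have hβ := S.tendsto_β_atTop hlam h2
  rw [cdf_eq_real]
  set q := (S.palmLaw μ lam mark).real (Set.Iic x) with hq
  set K : ℝ → ℝ := fun T => (markCount mark (Set.Iic x) 0 T (S.marked ω)).toReal with hK
  have hKmono : ∀ s t, 0 ≤ s → s ≤ t → K s ≤ K t := fun s t hs hst =>
    ENNReal.toReal_mono (markCount_ne_top hβ le_rfl (hs.trans hst)) (markCount_mono hs hst _)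
  have hKβ : ∀ N : ℕ, ∑ n ∈ Finset.Icc 1 N, (Set.Iic x).indicator (fun _ => (1 : ℝ)) (Y n ω)
      = K (S.β N ω) := by
    intro N
    rw [sum_Icc_eq_sum_range, hK]
    simp only [hY]
    rw [markCount_eq_sum hβ (S.β_nonneg N ω), updates_β,
      ENNReal.toReal_ofReal (Finset.sum_nonneg fun _ _ => indicator_one_nonneg _ _)]
  simp only [hKβ]
  let f : ℕ → ℕ := fun N => ⌊S.β N ω⌋₊
  have hf : Tendsto f atTop atTop := tendsto_nat_floor_atTop.comp hβ
  have hβN : Tendsto (fun N : ℕ => S.β N ω / N) atTop (𝓝 lam⁻¹) :=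
    ((S.tendsto_div_β hlam h2).inv₀ hlam.ne').congr fun N => inv_div _ _
  have hfN : Tendsto (fun N : ℕ => (f N : ℝ) / N) atTop (𝓝 lam⁻¹) := by
    have := ((tendsto_nat_floor_div_atTop (R := ℝ)).comp hβ).mul hβN
    rw [one_mul] at this
    refine this.congr' ?_
    filter_upwards [hβ.eventually_gt_atTop 0] with N hN
    simp only [Function.comp, f]
    field_simp
  have hf1N : Tendsto (fun N : ℕ => ((f N + 1 : ℕ) : ℝ) / N) atTop (𝓝 lam⁻¹) := by
    have := hfN.add tendsto_one_div_atTop_nhds_zero_nat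
    rw [add_zero] at this
    refine this.congr fun N => ?_
    push_cast
    rw [add_div]
  have hlimq : lam⁻¹ * (lam * q) = q := by rw [← mul_assoc, inv_mul_cancel₀ hlam.ne', one_mul]
  have hlow := hfN.mul (h1.comp hf)
  have hup := hf1N.mul (h1.comp ((tendsto_add_atTop_nat 1).comp hf))
  rw [hlimq] at hlow hup
  refine tendsto_of_tendsto_of_tendsto_of_le_of_le' hlow hup ?_ ?_
  · filter_upwards [hf.eventually_gt_atTop 0] with N hN
    have hN' : (0 : ℝ) < f N := by exact_mod_cast hN
    have h3 := hKmono (f N) _ hN'.le (Nat.floor_le (S.β_nonneg N ω))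
    calc _ = (1 / (N : ℝ)) * K (f N) := by simp only [Function.comp, hK]; field_simp
      _ ≤ _ := by gcongr
  · refine Eventually.of_forall fun N => ?_
    have hN' : (0 : ℝ) < ((f N + 1 : ℕ) : ℝ) := by positivity
    have h3 := hKmono _ ((f N + 1 : ℕ) : ℝ) (S.β_nonneg N ω) (by
      push_cast; exact (Nat.lt_floor_add_one _).le)
    calc _ ≤ (1 / (N : ℝ)) * K ((f N + 1 : ℕ) : ℝ) := by gcongr
      _ = _ := by simp only [Function.comp, hK]; field_simp

lemma map_aoi (h : S.TimeStationaryErgodic μ) {t : ℝ} (ht : 0 ≤ t) :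
    μ.map (S.aoi t) = μ.map (S.delay 0) :=
  map_comp_markedFrom h (g := fun z => (z 0).2) (measurable_snd.comp (measurable_pi_apply 0)) ht

end FIFOSystem

/-! ### The law of the AoI under stationarity in time. -/

namespace FIFOSystem

variable {Ω : Type*} [MeasurableSpace Ω] {S : FIFOSystem Ω} {μ : Measure Ω} {lam : ℝ}

/-- The set of the `(t, ω)` at which the AoI is at most `x`. -/
def aoiSublevel (S : FIFOSystem Ω) (x : ℝ) : Set (ℝ × Ω) :=
  ⋃ n : ℕ, {q | S.β n q.2 ≤ q.1 ∧ q.1 < S.β (n + 1) q.2 ∧ q.1 - S.α n q.2 ≤ x}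

/-- Describing the sublevel set cycle by cycle avoids the supremum in `updates` and yields the joint
measurability that Fubini requires. -/
lemma measurableSet_aoiSublevel (x : ℝ) : MeasurableSet (S.aoiSublevel x) :=
  .iUnion fun n => (measurableSet_le ((S.measurable_β n).comp measurable_snd) measurable_fst).inter
    ((measurableSet_lt measurable_fst ((S.measurable_β (n + 1)).comp measurable_snd)).inter
      (measurableSet_le (measurable_fst.sub ((S.measurable_α n).comp measurable_snd))
        measurable_const))

lemma indicator_aoiSublevel {ω : Ω} (hβ : Tendsto (fun n => S.β n ω) atTop atTop) (x : ℝ) {t : ℝ}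
    (ht : 0 ≤ t) :
    (S.aoiSublevel x).indicator (fun _ => (1 : ℝ)) (t, ω) = leInd x (S.aoi t ω) := by
  have h1 := β_updates_le hβ ht
  have h2 := lt_β_updates_succ hβ t
  by_cases hx : S.aoi t ω ≤ x
  · rw [leInd_of_le hx]
    have hmem : (t, ω) ∈ S.aoiSublevel x := Set.mem_iUnion.2 ⟨S.updates t ω, h1, h2, hx⟩
    exact Set.indicator_of_mem hmem _
  · rw [leInd_of_lt (not_le.1 hx)]
    refine Set.indicator_of_notMem (fun hmem => hx ?_) _
    obtain ⟨n, h3, h4, h5⟩ := Set.mem_iUnion.1 hmem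
    rw [S.aoi_eq h3 h4]
    exact h5

variable [IsProbabilityMeasure μ]

/-- In a system that is stationary in time, the mean fraction of time at which the AoI is at
most `x` is the probability that the AoI at a given time is at most `x`. -/
lemma integral_timeAverage (hlam : 0 < lam) (hdep : S.HasDepartureRate μ lam)
    (h : S.TimeStationaryErgodic μ) (x : ℝ) {T : ℝ} (hT : 0 < T) :
    AEStronglyMeasurable
      (fun ω => (1 / T) * ∫ t in (0 : ℝ)..T, leInd x (S.aoi t ω)) μ ∧
    ∫ ω, ((1 / T) * ∫ t in (0 : ℝ)..T, leInd x (S.aoi t ω)) ∂μ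
      = (μ.map (S.delay 0)).real (Set.Iic x) := by
  have hβ := ae_tendsto_β hlam hdep
  let g : ℝ × Ω → ℝ := (S.aoiSublevel x).indicator fun _ => (1 : ℝ)
  have hg : Measurable g := measurable_const.indicator (measurableSet_aoiSublevel x)
  have heq : (fun ω => (1 / T) * ∫ t in (0 : ℝ)..T, leInd x (S.aoi t ω))
      =ᵐ[μ] fun ω => (1 / T) * ∫ t in Set.Ioc 0 T, g (t, ω) := by
    filter_upwards [hβ] with ω hω
    rw [intervalIntegral.integral_of_le hT.le]
    congr 1
    refine setIntegral_congr_fun measurableSet_Ioc fun t ht => ?_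
    exact (indicator_aoiSublevel hω x ht.1.le).symm
  have hint : Integrable (Function.uncurry fun ω t => g (t, ω))
      (μ.prod (volume.restrict (Set.Ioc 0 T))) := by
    refine Integrable.of_bound (hg.comp measurable_swap).aestronglyMeasurable 1
      (Eventually.of_forall fun q => ?_)
    exact (norm_indicator_le_norm_self (fun _ => (1 : ℝ)) (q.2, q.1)).trans norm_one.le
  refine ⟨(AEStronglyMeasurable.congr ?_ heq.symm), ?_⟩
  · exact hint.integral_prod_left.aestronglyMeasurable.const_mul _
  · rw [integral_congr_ae heq, integral_const_mul, integral_integral_swap hint]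
    have h1 : ∀ t, 0 ≤ t → ∫ ω, g (t, ω) ∂μ = (μ.map (S.delay 0)).real (Set.Iic x) := by
      intro t ht
      have hae : AEMeasurable (S.aoi t) μ := by
        have : Measurable fun z : ℕ → ℝ × ℝ => (z 0).2 :=
          measurable_snd.comp (measurable_pi_apply 0)
        exact this.comp_aemeasurable (aemeasurable_markedFrom h ht)
      rw [← map_aoi h ht, ← integral_indicator_one measurableSet_Iic,
        integral_map hae (measurable_one.indicator measurableSet_Iic).aestronglyMeasurable]
      refine integral_congr_ae ?_
      filter_upwards [hβ] with ω hω
      exact indicator_aoiSublevel hω x ht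
    rw [setIntegral_congr_fun measurableSet_Ioc fun t ht => h1 t ht.1.le, setIntegral_const]
    simp only [measureReal_def, Real.volume_Ioc, sub_zero, ENNReal.toReal_ofReal hT.le, smul_eq_mul]
    field_simp

/-- The mean of the time average up to `n` is `P(D_0 ≤ x)` for every `n ≥ 1`, while the time average
converges almost surely to the mass of `Iic x` under `aoiLaw`. Bounded convergence identifies the
two, so `aoiLaw` is a probability measure. -/
theorem map_delay_zero_eq_aoiLaw (hlam : 0 < lam) (hdep : S.HasDepartureRate μ lam)
    (h : S.TimeStationaryErgodic μ) {PD PP : Measure ℝ} (hD : IsFrequencyLaw μ S.delay PD)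
    (hP : IsFrequencyLaw μ S.peak PP) (hPP : IsNonnegLaw PP) :
    μ.map (S.delay 0) = aoiLaw lam PD PP := by
  have hle := S.cdf_peak_le_cdf_delay hD hP hPP
  have hlaw : IsNonnegLaw (μ.map (S.delay 0)) :=
    isNonnegLaw_map (S.measurable_delay 0).aemeasurable (Eventually.of_forall (S.delay_nonneg 0))
  have := hlaw.isProbability
  refine Measure.ext_of_Iic _ _ fun x => ?_
  rcases lt_or_ge x 0 with hx | hx
  · rw [aoiLaw_Iic_of_neg _ _ _ hx, ← ofReal_cdf, hlaw.cdf_of_neg hx, ENNReal.ofReal_zero]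
  · rw [aoiLaw_Iic (fun x => mul_nonneg hlam.le (sub_nonneg.2 (hle x))) hx, ← ofReal_cdf]
    congr 1
    rw [cdf_eq_real]
    set L := lam * ∫ u in (0 : ℝ)..x, (cdf PD u - cdf PP u)
    have h1 : Tendsto (fun n : ℕ => ∫ ω, ((1 / (n : ℝ)) *
        ∫ t in (0 : ℝ)..(n : ℝ), leInd x (S.aoi t ω)) ∂μ) atTop (𝓝 (∫ _ω, L ∂μ)) := by
      refine tendsto_integral_filter_of_dominated_convergence (fun _ => (1 : ℝ)) ?_ ?_
        (integrable_const _) ?_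
      · filter_upwards [eventually_gt_atTop 0] with n hn
        exact (integral_timeAverage hlam hdep h x (by exact_mod_cast hn)).1
      · filter_upwards [eventually_gt_atTop 0] with n hn
        refine Eventually.of_forall fun ω => ?_
        have hn' : (0 : ℝ) < n := by exact_mod_cast hn
        have h2 := intervalIntegral.norm_integral_le_of_norm_le_const (a := 0) (b := (n : ℝ))
          (f := fun t => leInd x (S.aoi t ω)) (C := 1) fun t _ => by
            rw [Real.norm_of_nonneg (leInd_nonneg _ _)]; exact leInd_le_one _ _
        rw [sub_zero, one_mul, abs_of_pos hn'] at h2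
        rw [norm_mul, Real.norm_of_nonneg (by positivity : (0 : ℝ) ≤ 1 / n), one_div,
          inv_mul_le_iff₀ hn', mul_one]
        exact h2
      · filter_upwards [hdep, hD, hP] with ω h1 h2 h3
        exact (S.tendsto_timeAverage hlam h1 h2 h3 hx).comp tendsto_natCast_atTop_atTop
    rw [integral_const, probReal_univ, one_smul] at h1
    refine tendsto_nhds_unique (tendsto_const_nhds.congr' ?_) h1
    filter_upwards [eventually_gt_atTop 0] with n hn
    exact (integral_timeAverage hlam hdep h x (by exact_mod_cast hn)).2.symm

/-- The stationary laws of a system that is stationary in time. -/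
theorem exists_laws_of_time (hlam : 0 < lam) (hdep : S.HasDepartureRate μ lam)
    (h : S.TimeStationaryErgodic μ) :
    ∃ PD PP : Measure ℝ, IsNonnegLaw PD ∧ IsNonnegLaw PP ∧ IsFrequencyLaw μ S.delay PD ∧
      IsFrequencyLaw μ S.peak PP ∧ IsProbabilityMeasure (aoiLaw lam PD PP) ∧
      (∀ t : ℝ, 0 ≤ t → μ.map (S.aoi t) = aoiLaw lam PD PP) ∧
      (∀ t : ℝ, 0 ≤ t → ∀ B : Set ℝ, MeasurableSet B →
        ∑' n : ℕ, μ {ω | S.β (n + 1) ω ≤ t ∧ S.delay (n + 1) ω ∈ B}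
          = ENNReal.ofReal (lam * t) * PD B) ∧
      (∀ t : ℝ, 0 ≤ t → ∀ B : Set ℝ, MeasurableSet B →
        ∑' n : ℕ, μ {ω | S.β (n + 1) ω ≤ t ∧ S.peak (n + 1) ω ∈ B}
          = ENNReal.ofReal (lam * t) * PP B) := by
  have hpk : ∀ n ω, S.peak (n + 1) ω
      = (S.marked ω (n + 1)).1 - (S.marked ω n).1 + (S.marked ω n).2 := by
    intro n ω
    simp only [peak, marked, delay, Nat.add_sub_cancel]
    ring
  have hD := isFrequencyLaw_palmLaw hlam hdep h S.isMark_delay (Y := S.delay) fun n ω => rfl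
  have hP := isFrequencyLaw_palmLaw hlam hdep h S.isMark_peak (Y := S.peak) hpk
  have hPP := isNonnegLaw_palmLaw hlam hdep h S.isMark_peak
  have hA := map_delay_zero_eq_aoiLaw hlam hdep h hD hP hPP
  refine ⟨_, _, isNonnegLaw_palmLaw hlam hdep h S.isMark_delay, hPP, hD, hP, ?_,
    fun t ht => (map_aoi h ht).trans hA,
    fun t ht B hB => tsum_measure_eq_palmLaw hlam hdep h S.isMark_delay hB ht,
    fun t ht B hB => ?_⟩
  · rw [← hA]
    exact Measure.isProbabilityMeasure_map (S.measurable_delay 0).aemeasurable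
  · simp only [hpk]
    exact tsum_measure_eq_palmLaw hlam hdep h S.isMark_peak hB ht

end FIFOSystem

/-! ### Laplace–Stieltjes transforms and moments. -/

section Transforms

variable {lam : ℝ} {PD PP : Measure ℝ}

/-- The layer cake formula for the measure `aoiLaw lam PD PP`. -/
lemma ofReal_mul_lintegral_primitive (hlam : 0 < lam) (hPD : IsNonnegLaw PD)
    (hPP : IsNonnegLaw PP) (hle : ∀ x, cdf PP x ≤ cdf PD x) {g : ℝ → ℝ} (hgm : Measurable g)
    (hg0 : ∀ t, 0 ≤ t → 0 ≤ g t) (hgi : ∀ t > 0, IntervalIntegrable g volume 0 t) :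
    ENNReal.ofReal lam * ∫⁻ x, ENNReal.ofReal (∫ t in (0 : ℝ)..x, g t) ∂PP
      = ENNReal.ofReal lam * ∫⁻ x, ENNReal.ofReal (∫ t in (0 : ℝ)..x, g t) ∂PD
        + ∫⁻ x, ENNReal.ofReal (g x) ∂aoiLaw lam PD PP := by
  have := hPD.isProbability
  have := hPP.isProbability
  have hgn : ∀ᵐ t ∂volume.restrict (Set.Ioi (0 : ℝ)), 0 ≤ g t := by
    filter_upwards [ae_restrict_mem measurableSet_Ioi] with t ht using hg0 t (le_of_lt ht)
  have hlc : ∀ ν : Measure ℝ, IsNonnegLaw ν →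
      ∫⁻ x, ENNReal.ofReal (∫ t in (0 : ℝ)..x, g t) ∂ν
        = ∫⁻ t in Set.Ioi 0, ν (Set.Ioi t) * ENNReal.ofReal (g t) := fun ν hν =>
    lintegral_comp_eq_lintegral_meas_lt_mul ν hν.nonneg aemeasurable_id hgi hgn
  have htail : ∀ (ν : Measure ℝ), IsNonnegLaw ν → ∀ t, ν (Set.Ioi t)
      = ENNReal.ofReal (1 - cdf ν t) := by
    intro ν hν t
    have := hν.isProbability
    rw [← Set.compl_Iic, prob_compl_eq_one_sub measurableSet_Iic, ← ofReal_cdf,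
      ENNReal.ofReal_sub _ (cdf_nonneg _ _), ENNReal.ofReal_one]
  have hdm : Measurable fun x => ENNReal.ofReal (lam * (cdf PD x - cdf PP x)) :=
    (measurable_const.mul ((measurable_cdf PD).sub (measurable_cdf PP))).ennreal_ofReal
  have htm : Measurable fun t => PD (Set.Ioi t) * ENNReal.ofReal (g t) := by
    simp only [htail PD hPD]
    exact (measurable_const.sub (measurable_cdf PD)).ennreal_ofReal.mul hgm.ennreal_ofReal
  rw [aoiLaw, lintegral_withDensity_eq_lintegral_mul _ hdm hgm.ennreal_ofReal,
    ← Measure.restrict_congr_set Ioi_ae_eq_Ici, hlc PP hPP, hlc PD hPD,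
    ← lintegral_const_mul' _ _ ENNReal.ofReal_ne_top,
    ← lintegral_const_mul' _ _ ENNReal.ofReal_ne_top, ← lintegral_add_left (htm.const_mul _)]
  -- At each level the tail of the peak is the tail of the delay plus `cdf PD t - cdf PP t`.
  refine lintegral_congr fun t => ?_
  rw [Pi.mul_apply, htail PP hPP, htail PD hPD, ENNReal.ofReal_mul hlam.le, mul_assoc,
    ← mul_add, ← add_mul, ← ENNReal.ofReal_add (sub_nonneg.2 (cdf_le_one _ _))
      (sub_nonneg.2 (hle t))]
  congr 4
  ring

/-- The layer cake identity is additive in `[0, ∞]`, so finiteness of the peak term makes both other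
terms finite. Only then can it be read as a difference of real integrals. -/
lemma integral_aoiLaw_of_primitive (hlam : 0 < lam) (hPD : IsNonnegLaw PD)
    (hPP : IsNonnegLaw PP) (hle : ∀ x, cdf PP x ≤ cdf PD x) {g G : ℝ → ℝ} (hgm : Measurable g)
    (hg0 : ∀ t, 0 ≤ t → 0 ≤ g t) (hgi : ∀ t > 0, IntervalIntegrable g volume 0 t)
    (hGm : Measurable G) (hG : ∀ x, ∫ t in (0 : ℝ)..x, g t = G x) (hint : Integrable G PP) :
    Integrable G PD ∧ Integrable g (aoiLaw lam PD PP) ∧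
      ∫ x, g x ∂aoiLaw lam PD PP = lam * (∫ x, G x ∂PP - ∫ x, G x ∂PD) := by
  have hG0 : ∀ x, 0 ≤ x → 0 ≤ G x := fun x hx => by
    rw [← hG]
    exact intervalIntegral.integral_nonneg hx fun t ht => hg0 t ht.1
  have hP0 : 0 ≤ᵐ[PP] G := by filter_upwards [hPP.nonneg] with x hx using hG0 x hx
  have hD0 : 0 ≤ᵐ[PD] G := by filter_upwards [hPD.nonneg] with x hx using hG0 x hx
  have hA0 : 0 ≤ᵐ[aoiLaw lam PD PP] g := by
    filter_upwards [aoiLaw_nonneg lam PD PP] with x hx using hg0 x hx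
  have key := ofReal_mul_lintegral_primitive hlam hPD hPP hle hgm hg0 hgi
  simp only [hG] at key
  have hfin : ENNReal.ofReal lam * ∫⁻ x, ENNReal.ofReal (G x) ∂PP ≠ ⊤ :=
    ENNReal.mul_ne_top ENNReal.ofReal_ne_top
      ((lintegral_ofReal_ne_top_iff_integrable hint.aestronglyMeasurable hP0).2 hint)
  rw [key, ENNReal.add_ne_top] at hfin
  have hlam' : ENNReal.ofReal lam ≠ 0 := by simpa using hlam
  have hiD : Integrable G PD :=
    (lintegral_ofReal_ne_top_iff_integrable hGm.aestronglyMeasurable hD0).1 fun htop =>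
      hfin.1 (by rw [htop, ENNReal.mul_top hlam'])
  have hiA : Integrable g (aoiLaw lam PD PP) :=
    (lintegral_ofReal_ne_top_iff_integrable hgm.aestronglyMeasurable hA0).1 hfin.2
  refine ⟨hiD, hiA, ?_⟩
  rw [← ofReal_integral_eq_lintegral_ofReal hint hP0,
    ← ofReal_integral_eq_lintegral_ofReal hiD hD0,
    ← ofReal_integral_eq_lintegral_ofReal hiA hA0, ← ENNReal.ofReal_mul hlam.le,
    ← ENNReal.ofReal_mul hlam.le,
    ← ENNReal.ofReal_add (mul_nonneg hlam.le (integral_nonneg_of_ae hD0))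
      (integral_nonneg_of_ae hA0),
    ENNReal.ofReal_eq_ofReal_iff (mul_nonneg hlam.le (integral_nonneg_of_ae hP0))
      (add_nonneg (mul_nonneg hlam.le (integral_nonneg_of_ae hD0))
        (integral_nonneg_of_ae hA0))] at key
  linarith

/-- Take `g t = exp (-s t)`. Its primitive is bounded on the half-line, and the constants `1/s`
cancel because both laws have mass one. -/
theorem lst_aoiLaw (hlam : 0 < lam) (hPD : IsNonnegLaw PD) (hPP : IsNonnegLaw PP)
    (hle : ∀ x, cdf PP x ≤ cdf PD x) {s : ℝ} (hs : 0 < s) :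
    lst (aoiLaw lam PD PP) s = lam * ((lst PD s - lst PP s) / s) := by
  have hcont : Continuous fun t : ℝ => Real.exp (-s * t) := by fun_prop
  have hexp : ∀ ν : Measure ℝ, IsNonnegLaw ν → Integrable (fun x => Real.exp (-s * x)) ν := by
    intro ν hν
    have := hν.isProbability
    refine Integrable.of_bound hcont.aestronglyMeasurable 1 ?_
    filter_upwards [hν.nonneg] with x hx
    rw [Real.norm_of_nonneg (Real.exp_pos _).le, Real.exp_le_one_iff]
    nlinarith
  have hprim : ∀ x, ∫ t in (0 : ℝ)..x, Real.exp (-s * t) = (1 - Real.exp (-s * x)) / s := by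
    intro x
    have hd : ∀ t ∈ Set.uIcc 0 x,
        HasDerivAt (fun t => -(Real.exp (-s * t) / s)) (Real.exp (-s * t)) t := by
      intro t _
      have h1 := ((((hasDerivAt_id t).const_mul (-s)).exp).div_const s).neg
      refine h1.congr_deriv ?_
      simp only [id]
      field_simp
    rw [intervalIntegral.integral_eq_sub_of_hasDerivAt hd (hcont.intervalIntegrable _ _)]
    simp only [mul_zero, Real.exp_zero]
    ring
  have hGi : ∀ ν : Measure ℝ, IsNonnegLaw ν →
      Integrable (fun x => (1 - Real.exp (-s * x)) / s) ν := fun ν hν => by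
    have := hν.isProbability
    exact ((integrable_const 1).sub (hexp ν hν)).div_const s
  have hGv : ∀ ν : Measure ℝ, IsNonnegLaw ν →
      ∫ x, (1 - Real.exp (-s * x)) / s ∂ν = (1 - lst ν s) / s := fun ν hν => by
    have := hν.isProbability
    rw [integral_div, integral_sub (integrable_const 1) (hexp ν hν)]
    simp [lst]
  have := (integral_aoiLaw_of_primitive hlam hPD hPP hle hcont.measurable
    (fun t _ => (Real.exp_pos _).le) (fun t _ => hcont.intervalIntegrable _ _)
    (by fun_prop : Measurable fun x => (1 - Real.exp (-s * x)) / s) hprim (hGi PP hPP)).2.2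
  rw [hGv PP hPP, hGv PD hPD] at this
  rw [lst, this]
  ring

theorem moment_aoiLaw (hlam : 0 < lam) (hPD : IsNonnegLaw PD) (hPP : IsNonnegLaw PP)
    (hle : ∀ x, cdf PP x ≤ cdf PD x) (k : ℕ) (hint : Integrable (fun x : ℝ => x ^ (k + 1)) PP) :
    Integrable (fun x : ℝ => x ^ (k + 1)) PD ∧
      Integrable (fun x : ℝ => x ^ k) (aoiLaw lam PD PP) ∧
      ∫ x, x ^ k ∂aoiLaw lam PD PP
        = lam * ((∫ x, x ^ (k + 1) ∂PP - ∫ x, x ^ (k + 1) ∂PD) / (k + 1)) := by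
  have hcont : Continuous fun t : ℝ => t ^ k := by fun_prop
  have hk : ((k : ℝ) + 1) ≠ 0 := by positivity
  obtain ⟨h1, h2, h3⟩ := integral_aoiLaw_of_primitive hlam hPD hPP hle hcont.measurable
    (fun t ht => pow_nonneg ht k) (fun t _ => hcont.intervalIntegrable _ _)
    (by fun_prop : Measurable fun x : ℝ => x ^ (k + 1) / ((k : ℝ) + 1))
    (fun x => by simp [integral_pow]) (hint.div_const _)
  refine ⟨?_, h2, ?_⟩
  · refine (h1.mul_const ((k : ℝ) + 1)).congr (Eventually.of_forall fun x => ?_)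
    simp only
    field_simp
  · rw [h3, integral_div, integral_div, sub_div]

end Transforms

end

theorem theorem1 {Ω : Type*} [MeasurableSpace Ω] (μ : Measure Ω) [IsProbabilityMeasure μ]
    (S : FIFOSystem Ω) (lam : ℝ) (hlam : 0 < lam)
    (harr : S.HasArrivalRate μ lam) (hdep : S.HasDepartureRate μ lam)
    (hstat : S.TimeStationaryErgodic μ ∨ S.EventStationaryErgodic μ) :
    ∃ PA PD PP : Measure ℝ, S.AreStationaryLaws μ lam PA PD PP ∧
      -- (i) the density of the AoI
      ((∀ x : ℝ, 0 ≤ lam * (cdf PD x - cdf PP x)) ∧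
        PA = (volume.restrict (Set.Ici 0)).withDensity
          (fun x => ENNReal.ofReal (lam * (cdf PD x - cdf PP x)))) ∧
      -- (ii) the Laplace–Stieltjes transform of the AoI
      (∀ s : ℝ, 0 < s → lst PA s = lam * ((lst PD s - lst PP s) / s)) ∧
      -- (iii) the moments of the AoI
      (∀ k : ℕ, 1 ≤ k → Integrable (fun x : ℝ => x ^ (k + 1)) PP →
        Integrable (fun x : ℝ => x ^ (k + 1)) PD ∧ Integrable (fun x : ℝ => x ^ k) PA ∧
        ∫ x, x ^ k ∂PA =
          lam * ((∫ x, x ^ (k + 1) ∂PP - ∫ x, x ^ (k + 1) ∂PD) / (k + 1))) := by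
  obtain ⟨PD, PP, hPD, hPP, hD, hP, hA⟩ : ∃ PD PP : Measure ℝ, IsNonnegLaw PD ∧
      IsNonnegLaw PP ∧ IsFrequencyLaw μ S.delay PD ∧ IsFrequencyLaw μ S.peak PP ∧
      IsProbabilityMeasure (aoiLaw lam PD PP) := by
    rcases hstat with h | h
    · obtain ⟨PD, PP, h1, h2, h3, h4, h5, -⟩ := FIFOSystem.exists_laws_of_time hlam hdep h
      exact ⟨PD, PP, h1, h2, h3, h4, h5⟩
    · obtain ⟨PD, PP, h1, h2, h3, h4, h5, -⟩ := S.exists_laws_of_event hlam hdep h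
      exact ⟨PD, PP, h1, h2, h3, h4, h5⟩
  have hle := S.cdf_peak_le_cdf_delay hD hP hPP
  -- The two kinds of stationarity may hold together. Uniqueness of frequency laws identifies the
  -- laws built from either one with the chosen `PD` and `PP`.
  have hevent : S.EventStationaryErgodic μ →
      (∀ n, 1 ≤ n → μ.map (S.delay n) = PD) ∧ (∀ n, 1 ≤ n → μ.map (S.peak n) = PP) := by
    intro h
    obtain ⟨PD', PP', h1, h2, h3, h4, -, h6⟩ := S.exists_laws_of_event hlam hdep h
    rw [hD.unique h3 hPD h1, hP.unique h4 hPP h2]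
    exact h6
  have htime : S.TimeStationaryErgodic μ →
      (∀ t : ℝ, 0 ≤ t → μ.map (S.aoi t) = aoiLaw lam PD PP) ∧
      (∀ t : ℝ, 0 ≤ t → ∀ B : Set ℝ, MeasurableSet B →
        ∑' n : ℕ, μ {ω | S.β (n + 1) ω ≤ t ∧ S.delay (n + 1) ω ∈ B}
          = ENNReal.ofReal (lam * t) * PD B) ∧
      (∀ t : ℝ, 0 ≤ t → ∀ B : Set ℝ, MeasurableSet B →
        ∑' n : ℕ, μ {ω | S.β (n + 1) ω ≤ t ∧ S.peak (n + 1) ω ∈ B}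
          = ENNReal.ofReal (lam * t) * PP B) := by
    intro h
    obtain ⟨PD', PP', h1, h2, h3, h4, -, h6⟩ := FIFOSystem.exists_laws_of_time hlam hdep h
    rw [hD.unique h3 hPD h1, hP.unique h4 hPP h2]
    exact h6
  exact ⟨aoiLaw lam PD PP, PD, PP,
    { law_A := ⟨hA, aoiLaw_nonneg lam PD PP⟩
      law_D := hPD
      law_P := hPP
      freq_A := S.isTimeFrequencyLaw_aoiLaw hlam hdep hD hP hPP
      freq_D := hD
      freq_P := hP
      event_D := fun h => (hevent h).1
      event_P := fun h => (hevent h).2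
      time_A := fun h => (htime h).1
      time_D := fun h => (htime h).2.1
      time_P := fun h => (htime h).2.2 },
    ⟨fun x => mul_nonneg hlam.le (sub_nonneg.2 (hle x)), rfl⟩,
    fun s hs => lst_aoiLaw hlam hPD hPP hle hs,
    fun k _ hk => moment_aoiLaw hlam hPD hPP hle k hk⟩
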